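/- Let $t, n \ge 1$ and $m \ge 0$ be integers with $t < n$. Let $\lambda \vdash t$, i.e. $\lambda = (\lambda_1 \ge \lambda_2 \ge \dots \ge \lambda_s > 0)$ with $\sum_i \lambda_i = t$, and put $\lambda_i = 0$ for $i > s$. For a partition $\nu \vdash r$ and a Young tableau $T_\nu$ of shape $\nu$, filled bijectively with $r$ symbols, let $S(\nu) := (\mathbb{Z}S_r)\, b_{T_\nu} a_{T_\nu}$ be the integral Specht module, where $a_{T_\nu} = \sum_{\pi \in R_{T_\nu}} \pi$ and $b_{T_\nu} = \sum_{\sigma \in C_{T_\nu}} (\operatorname{sign}\sigma)\,\sigma$ are taken over the row stabilizer $R_{T_\nu}$ and the column stabilizer $C_{T_\nu}$ of $T_\nu$ (up to isomorphism, $S(\nu)$ does not depend on $T_\nu$). Let $\mathbb{Z}$ be the trivial $\mathbb{Z}S_{n-t}$-module. Then the induced $\mathbb{Z}S_n$-module $$\bigl(S(\lambda)/mS(\lambda)\bigr)\uparrow S_n := \mathbb{Z}S_n \otimes_{\mathbb{Z}(S_t \times S_{n-t})} \Bigl(\bigl(S(\lambda)/mS(\lambda)\bigr) \otimes_{\mathbb{Z}}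 \mathbb{Z}\Bigr)$$ has a finite series of $\mathbb{Z}S_n$-submodules $$\bigl(S(\lambda)/mS(\lambda)\bigr)\uparrow S_n = N_0 \supseteq N_1 \supseteq \dots \supseteq N_k = 0$$ and an enumeration $\nu^{(1)}, \dots, \nu^{(k)}$, each partition listed exactly once, of all partitions $\nu \vdash n$ satisfying $$\lambda_n \le \nu_n \le \lambda_{n-1} \le \nu_{n-1} \le \dots \le \lambda_2 \le \nu_2 \le \lambda_1 \le \nu_1,$$ such that $N_{i-1}/N_i \cong S(\nu^{(i)})/mS(\nu^{(i)})$ as $\mathbb{Z}S_n$-modules for every $1 \le i \le k$. -/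

import Mathlib

open scoped TensorProduct

noncomputable section

/-- The integral group ring `ℤ Sₙ`; `Sₙ` is the group of permutations of the `n` symbols `Fin n`. -/
abbrev IntSym (n : ℕ) : Type := MonoidAlgebra ℤ (Equiv.Perm (Fin n))

/-- A Young tableau `T_lam` of shape `lam ⊢ n`: every box of the diagram is filled with one of the `n`
symbols, each symbol being used exactly once. -/
abbrev YoungTableau (lam : YoungDiagram) (n : ℕ) : Type := {c : ℕ × ℕ // c ∈ lam.cells} ≃ Fin n

/-- Every diagram with `n` boxes carries a Young tableau. -/
theorem YoungTableau.nonempty_of_card {lam : YoungDiagram} {n : ℕ} (h : lam.card = n) :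
    Nonempty (YoungTableau lam n) :=
  ⟨lam.cells.equivFinOfCardEq h⟩

namespace YoungTableau

variable {lam : YoungDiagram} {n : ℕ}

/-- The (zero-based) row of the tableau that contains the symbol `x`. -/
def rowOf (T : YoungTableau lam n) (x : Fin n) : ℕ := (T.symm x).1.1

/-- The (zero-based) column of the tableau that contains the symbol `x`. -/
def colOf (T : YoungTableau lam n) (x : Fin n) : ℕ := (T.symm x).1.2

/-- The row stabilizer `R_T`: the permutations that keep every symbol in its row. -/
def rowStab (T : YoungTableau lam n) : Finset (Equiv.Perm (Fin n)) :=
  {p | ∀ x, T.rowOf (p x) = T.rowOf x}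

/-- The column stabilizer `C_T`: the permutations that keep every symbol in its column. -/
def colStab (T : YoungTableau lam n) : Finset (Equiv.Perm (Fin n)) :=
  {p | ∀ x, T.colOf (p x) = T.colOf x}

/-- `a_T = ∑_{π ∈ R_T} π`. -/
def rowSymmetrizer (T : YoungTableau lam n) : IntSym n :=
  ∑ p ∈ T.rowStab, MonoidAlgebra.single p 1

/-- `b_T = ∑_{σ ∈ C_T} (sign σ) σ`. -/
def colAntisymmetrizer (T : YoungTableau lam n) : IntSym n :=
  ∑ p ∈ T.colStab, MonoidAlgebra.single p (Equiv.Perm.sign p : ℤ)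

/-- The integral Specht module `S(lam) = (ℤ Sₙ) b_T a_T`, a left ideal of `ℤ Sₙ`. -/
def specht (T : YoungTableau lam n) : Submodule (IntSym n) (IntSym n) :=
  Submodule.span (IntSym n) {T.colAntisymmetrizer * T.rowSymmetrizer}

/-- The `ℤ Sₙ`-module `S(lam) / m S(lam)`. -/
abbrev SpechtMod (T : YoungTableau lam n) (m : ℕ) : Type :=
  T.specht ⧸ LinearMap.range (m • (LinearMap.id : T.specht →ₗ[IntSym n] T.specht))

end YoungTableau

/-- The embedding `S_t × S_{n-t} → Sₙ`: the first factor permutes the first `t` symbols, the second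
factor permutes the last `n - t` symbols. -/
def youngEmbedding {t n : ℕ} (h : t < n) :
    Equiv.Perm (Fin t) × Equiv.Perm (Fin (n - t)) →* Equiv.Perm (Fin n) :=
  ((finSumFinEquiv.trans (finCongr (Nat.add_sub_of_le h.le))).permCongrHom.toMonoidHom).comp
    (Equiv.Perm.sumCongrHom (Fin t) (Fin (n - t)))

/-- For a `ℤ S_t`-module `M`, the representation of `S_t × S_{n-t}` on `M ⊗ ℤ`, where `ℤ` is the trivial
`ℤ S_{n-t}`-module. -/
def outerTrivial (t n : ℕ) (M : Type) [AddCommGroup M] [Module (IntSym t) M] :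
    Representation ℤ (Equiv.Perm (Fin t) × Equiv.Perm (Fin (n - t))) (M ⊗[ℤ] ℤ) :=
  Representation.tprod
    ((Representation.ofModule' M).comp (MonoidHom.fst _ _))
    ((Representation.trivial ℤ (Equiv.Perm (Fin (n - t))) ℤ).comp (MonoidHom.snd _ _))

/-- The induced `ℤ Sₙ`-module `M ↑ Sₙ = ℤ Sₙ ⊗_{ℤ (S_t × S_{n-t})} (M ⊗_ℤ ℤ)`. -/
abbrev InducedUp {t n : ℕ} (h : t < n) (M : Type) [AddCommGroup M] [Module (IntSym t) M] : Type :=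
  (Representation.ind (youngEmbedding h) (outerTrivial t n M)).asModule

/-- `lam` and `nu` interlace: `… ≤ lam₃ ≤ nu₃ ≤ lam₂ ≤ nu₂ ≤ lam₁ ≤ nu₁`; the rows are numbered from
`0` here, and rows outside the diagram have length `0`. -/
def Interlaces (lam nu : YoungDiagram) : Prop :=
  ∀ i : ℕ, nu.rowLen (i + 1) ≤ lam.rowLen i ∧ lam.rowLen i ≤ nu.rowLen i

end

/-! ### Functions on words, fillings and their polytabloids. -/

noncomputable section

open Equiv

/-! Words in the row numbers, with an extra letter `none` for unused symbols, play the role of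
tabloids. Let L be the lattice spanned by the polytabloids of all fillings of λ by t of the n
symbols. It is the module induced from S(λ), the unused symbols accounting for the trivial factor.
The series is built in L and then reduced modulo m.

The standard polytabloids are unitriangular with respect to an order on words. Hence they are
linearly independent and their span is pure in the module of all functions
(`mem_standardSpan_of_smul_mem`). Garnir relations show that this span contains every polytabloid
(`IsTableau.polytabloid_mem`), so it is L. Purity permits division by nonzero integers and is used
throughout.

For ν ⊢ n the map `fillHom` replaces the letters `none` so that the content becomes ν. List the
interlacing ν by increasing depth ∑ i ν_i, and let the i-th stratum be the part of L killed by the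
first i of these maps. For a tableau u of shape ν, the column antisymmetrization of u with its boxes
outside λ erased (`stripElement`) lies in L. It is killed by the map of every other ν' of depth at
most that of ν, and the map of ν sends it to the polytabloid of u. So each stratum maps onto at
least the Specht lattice of its ν.

The number of standard fillings of λ by some of n symbols is the sum of the numbers of standard
tableaux of the interlacing ν (`sum_card_standards`). Comparing ranks, all these inclusions have
finite index, hence are equalities by purity, and the last stratum is zero (`IsStripList.map_eq`,
`IsStripList.stratum_eq_bot`). The strata are pure as well, so the series survives reduction modulo
m.

The left ideals S(ν) and the induced module are cyclic. They are identified with their models by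
comparing annihilators of generators (`smul_polytabloid_eq_zero_iff`, `smul_inducedMk_eq_zero_iff`).
-/

/-- Integer-valued functions on words of length `n`; the letter `some i` stands for row `i`, and `none`
marks a symbol outside the diagram. -/
abbrev WordModule (n : ℕ) : Type := (Fin n → Option ℕ) → ℤ

/-- The action of `Sₙ` on functions of words by permuting positions. -/
def wordRep (n : ℕ) : Representation ℤ (Perm (Fin n)) (WordModule n) where
  toFun g := LinearMap.funLeft ℤ ℤ (fun w : Fin n → Option ℕ => w ∘ g)
  map_one' := rfl
  map_mul' _ _ := rfl

@[simp] theorem wordRep_apply {n : ℕ} (g : Perm (Fin n)) (f : WordModule n) (w : Fin n → Option ℕ) :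
    wordRep n g f w = f (w ∘ g) := rfl

/-- The indicator function of a word. -/
abbrev wordDelta {n : ℕ} (w : Fin n → Option ℕ) : WordModule n := Pi.single w 1

theorem wordDelta_apply {n : ℕ} (w v : Fin n → Option ℕ) :
    wordDelta w v = if v = w then 1 else 0 := by
  simp [wordDelta, Pi.single_apply]

theorem wordRep_wordDelta {n : ℕ} (g : Perm (Fin n)) (w : Fin n → Option ℕ) :
    wordRep n g (wordDelta w) = wordDelta (w ∘ ⇑g⁻¹) := by
  ext v
  simp only [wordRep_apply, wordDelta_apply]
  congr 1
  refine propext ⟨?_, ?_⟩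
  · rintro rfl; ext x; simp
  · rintro rfl; ext x; simp

/-- An assignment of positions (boxes) to some of the symbols `Fin n`. -/
abbrev Filling (n : ℕ) : Type := Fin n → Option (ℕ × ℕ)

namespace Filling

variable {n : ℕ} {lam : YoungDiagram} {p q : Filling n}

/-- The word recording the row of every symbol. -/
def rowWord (p : Filling n) : Fin n → Option ℕ := fun x => (p x).map Prod.fst

theorem rowWord_of_eq_some {x : Fin n} {c : ℕ × ℕ} (h : p x = some c) : p.rowWord x = some c.1 := by
  simp [rowWord, h]

theorem rowWord_of_eq_none {x : Fin n} (h : p x = none) : p.rowWord x = none := by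
  simp [rowWord, h]

/-- `p` fills every box of `lam` with exactly one symbol. -/
structure IsTableau (lam : YoungDiagram) (p : Filling n) : Prop where
  mem_iff : ∀ c, c ∈ lam ↔ ∃ x, p x = some c
  inj : ∀ x y c, p x = some c → p y = some c → x = y

/-- `p` is a filling of `lam` in which the symbols increase along rows and columns. -/
structure IsStandard (lam : YoungDiagram) (p : Filling n) : Prop where
  mem_iff : ∀ c, c ∈ lam ↔ ∃ x, p x = some c
  le_of_le : ∀ x y c d, p x = some c → p y = some d → c ≤ d → x ≤ y

theorem IsStandard.isTableau (h : IsStandard lam p) : IsTableau lam p :=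
  ⟨h.mem_iff, fun x y c hx hy =>
    le_antisymm (h.le_of_le x y c c hx hy le_rfl) (h.le_of_le y x c c hy hx le_rfl)⟩

theorem IsTableau.comp (h : IsTableau lam p) (g : Perm (Fin n)) : IsTableau lam (p ∘ g) := by
  refine ⟨fun c => ?_, fun x y c hx hy => ?_⟩
  · rw [h.mem_iff]
    exact ⟨fun ⟨x, hx⟩ => ⟨g⁻¹ x, by simpa using hx⟩, fun ⟨x, hx⟩ => ⟨g x, hx⟩⟩
  · exact g.injective (h.inj _ _ c hx hy)

/-- The column stabilizer of a filling; it fixes the symbols that are not used. -/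
def colStab (p : Filling n) : Subgroup (Perm (Fin n)) where
  carrier := {s | ∀ x, (p (s x)).map Prod.snd = (p x).map Prod.snd ∧ (p x = none → s x = x)}
  one_mem' x := by simp
  mul_mem' {a b} ha hb x := by
    refine ⟨((ha (b x)).1).trans (hb x).1, fun h => ?_⟩
    have h1 := (hb x).2 h
    rw [Perm.mul_apply, h1, (ha x).2 h]
  inv_mem' {a} ha x := by
    have h0 := ha (a⁻¹ x)
    rw [show a (a⁻¹ x) = x by simp] at h0
    refine ⟨h0.1.symm, fun h => ?_⟩
    rw [Perm.inv_eq_iff_eq]; exact ((ha x).2 h).symm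

theorem mem_colStab {s : Perm (Fin n)} : s ∈ p.colStab ↔
    ∀ x, (p (s x)).map Prod.snd = (p x).map Prod.snd ∧ (p x = none → s x = x) := Iff.rfl

theorem mem_colStab_comp {g s : Perm (Fin n)} :
    s ∈ colStab (p ∘ ⇑g⁻¹) ↔ g⁻¹ * s * g ∈ p.colStab := by
  simp only [mem_colStab, Function.comp, Perm.mul_apply]
  constructor
  · intro h x
    have := h (g x)
    rw [show g⁻¹ (g x) = x by simp] at this
    exact ⟨this.1, fun hx => by rw [this.2 hx]; simp⟩
  · intro h x
    have := h (g⁻¹ x)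
    rw [show g (g⁻¹ x) = x by simp] at this
    exact ⟨this.1, fun hx => g⁻¹.injective (this.2 hx)⟩

theorem swap_mem_colStab {x y : Fin n} {c d : ℕ × ℕ} (hx : p x = some c) (hy : p y = some d)
    (h : c.2 = d.2) : swap x y ∈ p.colStab := by
  intro z
  rcases eq_or_ne z x with rfl | hzx
  · simp [hx, hy, h]
  rcases eq_or_ne z y with rfl | hzy
  · simp [hx, hy, h]
  rw [swap_apply_of_ne_of_ne hzx hzy]; simp

open scoped Classical in
/-- The signed sum over the column stabilizer, acting on functions of words. -/
def antisym (p : Filling n) : WordModule n →ₗ[ℤ] WordModule n :=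
  ∑ s : p.colStab, (Perm.sign s.1 : ℤ) • wordRep n s.1

open scoped Classical in
theorem antisym_eq (p : Filling n) (f : WordModule n) :
    p.antisym f = ∑ s : p.colStab, (Perm.sign s.1 : ℤ) • wordRep n s.1 f := by
  simp [antisym, LinearMap.sum_apply]

open scoped Classical in
theorem antisym_apply (p : Filling n) (f : WordModule n) (w : Fin n → Option ℕ) :
    p.antisym f w = ∑ s : p.colStab, (Perm.sign s.1 : ℤ) * f (w ∘ s.1) := by
  simp [antisym_eq, Finset.sum_apply]

theorem antisym_wordRep {s : Perm (Fin n)} (hs : s ∈ p.colStab) (f : WordModule n) :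
    p.antisym (wordRep n s f) = (Perm.sign s : ℤ) • p.antisym f := by
  classical
  rw [antisym_eq, antisym_eq, Finset.smul_sum,
    ← Equiv.sum_comp (Equiv.mulRight (⟨s, hs⟩ : p.colStab)) (fun a => (Perm.sign s : ℤ) • _)]
  refine Finset.sum_congr rfl fun a _ => ?_
  rw [smul_smul, Equiv.coe_mulRight, Subgroup.coe_mul, map_mul, map_mul, Module.End.mul_apply]
  congr 1
  rcases Int.units_eq_one_or (Perm.sign s) with h | h <;> simp [h]

theorem wordRep_antisym {s : Perm (Fin n)} (hs : s ∈ p.colStab) (f : WordModule n) :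
    wordRep n s (p.antisym f) = (Perm.sign s : ℤ) • p.antisym f := by
  classical
  rw [antisym_eq, map_sum, Finset.smul_sum,
    ← Equiv.sum_comp (Equiv.mulLeft (⟨s, hs⟩ : p.colStab)) (fun a => (Perm.sign s : ℤ) • _)]
  refine Finset.sum_congr rfl fun a _ => ?_
  rw [smul_smul, Equiv.coe_mulLeft, Subgroup.coe_mul, map_mul, map_mul, Module.End.mul_apply, map_smul]
  congr 1
  rcases Int.units_eq_one_or (Perm.sign s) with h | h <;> simp [h]

/-- The letters of `w` are distinct in every column of `p`. -/
def ColInjective (p : Filling n) (w : Fin n → Option ℕ) : Prop :=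
  ∀ x y c d, p x = some c → p y = some d → c.2 = d.2 → w x = w y → x = y

theorem ColInjective.comp {w : Fin n → Option ℕ} (h : p.ColInjective w) {s : Perm (Fin n)}
    (hs : s ∈ p.colStab) : p.ColInjective (w ∘ s) := by
  intro x y c d hx hy hcd hw
  have h1 := (hs x).1
  have h2 := (hs y).1
  rw [hx, Option.map_some, Option.map_eq_some_iff] at h1
  rw [hy, Option.map_some, Option.map_eq_some_iff] at h2
  obtain ⟨c', hc', e1⟩ := h1
  obtain ⟨d', hd', e2⟩ := h2
  exact s.injective (h _ _ _ _ hc' hd' (by rw [e1, e2, hcd]) hw)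

/-- The antisymmetrizer only sees the values on column injective words. -/
theorem antisym_congr {f f' : WordModule n} (h : ∀ w, p.ColInjective w → f w = f' w) :
    p.antisym f = p.antisym f' := by
  classical
  ext w
  by_cases hw : p.ColInjective w
  · rw [antisym_apply, antisym_apply]
    exact Finset.sum_congr rfl fun s _ => by rw [h _ (hw.comp s.2)]
  -- Two symbols of one column carry the same letter: their transposition fixes `w` but changes the
  -- sign, so the value equals its own negative.
  · have key : ∀ f : WordModule n, p.antisym f w = 0 := by
      intro f
      simp only [ColInjective, not_forall] at hw
      obtain ⟨x, y, c, d, hx, hy, hcd, hwxy, hne⟩ := hw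
      have h1 := congrFun (wordRep_antisym (swap_mem_colStab hx hy hcd) f) w
      have h2 : w ∘ swap x y = w := by
        ext1 z
        rcases eq_or_ne z x with rfl | hzx
        · simp [hwxy]
        rcases eq_or_ne z y with rfl | hzy
        · simp [hwxy]
        simp [swap_apply_of_ne_of_ne hzx hzy]
      rw [wordRep_apply, h2, Perm.sign_swap hne] at h1
      simp at h1
      omega
    rw [key, key]

/-- The polytabloid of a filling. -/
def polytabloid (p : Filling n) : WordModule n := p.antisym (wordDelta p.rowWord)

theorem wordRep_polytabloid (g : Perm (Fin n)) (p : Filling n) :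
    wordRep n g p.polytabloid = polytabloid (p ∘ ⇑g⁻¹) := by
  classical
  rw [polytabloid, polytabloid, antisym_eq, antisym_eq, map_sum]
  refine Fintype.sum_equiv
    ((MulAut.conj g).toEquiv.subtypeEquiv fun s => by
      rw [mem_colStab_comp]; simp [mul_assoc]) _ _ fun s => ?_
  have e : rowWord (p ∘ ⇑g⁻¹) = p.rowWord ∘ ⇑g⁻¹ := rfl
  have h2 : (((MulAut.conj g).toEquiv.subtypeEquiv (fun s => by
      rw [mem_colStab_comp]; simp [mul_assoc]) : p.colStab ≃ colStab (p ∘ ⇑g⁻¹)) s).1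
        = g * s.1 * g⁻¹ := rfl
  have h3 : Perm.sign (g * s.1 * g⁻¹) = Perm.sign s.1 := by
    rw [map_mul, map_mul, map_inv, mul_comm, inv_mul_cancel_left]
  rw [h2, h3, e, map_smul, ← wordRep_wordDelta, ← Module.End.mul_apply, ← Module.End.mul_apply,
    ← map_mul, ← map_mul, inv_mul_cancel_right]

theorem polytabloid_comp_of_mem_colStab {s : Perm (Fin n)} (hs : s ∈ p.colStab) :
    polytabloid (p ∘ s) = (Perm.sign s : ℤ) • p.polytabloid := by
  have h := wordRep_polytabloid s⁻¹ p
  rw [inv_inv] at h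
  rw [← h, polytabloid, wordRep_antisym (inv_mem hs)]; simp

theorem exists_of_polytabloid_ne_zero {w : Fin n → Option ℕ} (h : p.polytabloid w ≠ 0) :
    ∃ s ∈ p.colStab, w = p.rowWord ∘ s := by
  classical
  rw [polytabloid, antisym_apply] at h
  obtain ⟨s, -, hs⟩ := Finset.exists_ne_zero_of_sum_ne_zero h
  refine ⟨s.1⁻¹, inv_mem s.2, ?_⟩
  rw [wordDelta_apply] at hs
  have : w ∘ s.1 = p.rowWord := by by_contra hc; simp [hc] at hs
  rw [← this]; ext1 x; simp

/-! ### Unitriangularity and purity of the standard polytabloids. -/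

/-- Words are compared at the largest symbol where they differ. -/
def wordKey (w : Fin n → Option ℕ) : Lex ((Fin n)ᵒᵈ → ℕ) :=
  toLex fun x => (w (OrderDual.ofDual x)).getD 0

theorem wordKey_lt {w v : Fin n → Option ℕ} (x : Fin n) (h : ∀ y, x < y → w y = v y)
    (hx : (w x).getD 0 < (v x).getD 0) : wordKey w < wordKey v :=
  ⟨OrderDual.toDual x, fun y hy => by
    simp only [wordKey]
    exact congrArg (fun o : Option ℕ => o.getD 0) (h (OrderDual.ofDual y) hy), hx⟩

/-- At the largest moved symbol `x` one has `s x < x`, so standardness puts `s x` strictly higher in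
the column of `x`, and the letter at `x` drops while all later letters stay. Reading `none` as `0`
is harmless, since unused symbols are not moved. -/
theorem IsStandard.wordKey_comp_lt (h : IsStandard lam p) {s : Perm (Fin n)} (hs : s ∈ p.colStab)
    (h1 : s ≠ 1) : wordKey (p.rowWord ∘ s) < wordKey p.rowWord := by
  classical
  obtain ⟨x, hx, hmax⟩ : ∃ x, s x ≠ x ∧ ∀ y, x < y → s y = y := by
    have hne : (Finset.univ.filter fun x => s x ≠ x).Nonempty := by
      by_contra hc
      rw [Finset.not_nonempty_iff_eq_empty, Finset.filter_eq_empty_iff] at hc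
      exact h1 (Perm.ext fun x => by simpa using hc (Finset.mem_univ x))
    refine ⟨Finset.max' _ hne, (Finset.mem_filter.1 (Finset.max'_mem _ hne)).2, fun y hy => ?_⟩
    by_contra hc
    exact absurd (Finset.le_max' _ y (by simpa using hc)) (not_le.2 hy)
  have hlt : s x < x := by
    rcases lt_trichotomy (s x) x with h | h | h
    · exact h
    · exact absurd h hx
    · exact absurd (s.injective (hmax _ h)) hx
  refine wordKey_lt x (fun y hy => by simp [hmax y hy]) ?_
  obtain ⟨h2, h3⟩ := hs x
  cases hpx : p x with
  | none => exact absurd (h3 hpx) hx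
  | some c =>
    rw [hpx, Option.map_some, Option.map_eq_some_iff] at h2
    obtain ⟨d, hd, e⟩ := h2
    rw [Function.comp, rowWord_of_eq_some hd, rowWord_of_eq_some hpx]
    simp only [Option.getD_some]
    by_contra hc
    exact absurd (h.le_of_le x (s x) c d hpx hd ⟨not_lt.1 hc, e.ge⟩) (not_le.2 hlt)

theorem IsStandard.polytabloid_self (h : IsStandard lam p) : p.polytabloid p.rowWord = 1 := by
  classical
  rw [polytabloid, antisym_apply, Finset.sum_eq_single 1]
  · simp
  · intro s _ hs
    have := (h.wordKey_comp_lt s.2 (by simpa using hs)).ne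
    rw [wordDelta_apply, if_neg (fun e => this (by rw [e])), mul_zero]
  · simp

/-- The smaller symbols of the same row are exactly those further left. Thus the row word of a
standard filling determines the filling. -/
theorem IsStandard.col_eq_card (h : IsStandard lam p) {x : Fin n} {i j : ℕ}
    (hx : p x = some (i, j)) :
    j = (Finset.univ.filter fun y => y < x ∧ p.rowWord y = some i).card := by
  classical
  have hc : (i, j) ∈ lam := (h.mem_iff _).2 ⟨x, hx⟩
  have hex : ∀ k ∈ Finset.range j, ∃ y, p y = some (i, k) := fun k hk =>
    (h.mem_iff _).1 (lam.up_left_mem le_rfl (Finset.mem_range.1 hk).le hc)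
  choose f hf using hex
  refine (Finset.card_range j).symm.trans (Finset.card_bij f ?_ ?_ ?_)
  · intro k hk
    have hle := h.le_of_le _ _ _ _ (hf k hk) hx ⟨le_rfl, (Finset.mem_range.1 hk).le⟩
    have hne : f k hk ≠ x := fun e => by
      have := hf k hk
      rw [e, hx] at this
      simp at this
      simp [this] at hk
    simp [lt_of_le_of_ne hle hne, rowWord_of_eq_some (hf k hk)]
  · intro k hk l hl e
    have := hf k hk
    rw [e, hf l hl] at this
    simpa using this.symm
  · intro y hy
    simp only [Finset.mem_filter, Finset.mem_univ, true_and, rowWord, Option.map_eq_some_iff] at hy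
    obtain ⟨hlt, ⟨a, k⟩, hy, rfl⟩ := hy
    have hk : k < j := by
      by_contra hc
      exact absurd (h.le_of_le _ _ _ _ hx hy ⟨le_rfl, not_lt.1 hc⟩) (not_le.2 hlt)
    refine ⟨k, Finset.mem_range.2 hk, h.isTableau.inj _ _ _ (hf k _) hy⟩

theorem IsStandard.eq_of_rowWord_eq (hp : IsStandard lam p) (hq : IsStandard lam q)
    (e : p.rowWord = q.rowWord) : p = q := by
  ext1 x
  have hx := congrFun e x
  cases hpx : p x with
  | none =>
    cases hqx : q x with
    | none => rfl
    | some d => simp [rowWord, hpx, hqx] at hx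
  | some c =>
    cases hqx : q x with
    | none => simp [rowWord, hpx, hqx] at hx
    | some d =>
      obtain ⟨i, j⟩ := c
      obtain ⟨i', j'⟩ := d
      simp only [rowWord, hpx, hqx, Option.map_some, Option.some.injEq] at hx
      subst hx
      have h1 := hp.col_eq_card hpx
      have h2 := hq.col_eq_card hqx
      rw [e] at h1
      rw [h1, h2]

theorem IsStandard.wordKey_lt_of_ne_zero (hp : IsStandard lam p) (hq : IsStandard lam q)
    (h : p.polytabloid q.rowWord ≠ 0) : p = q ∨ wordKey q.rowWord < wordKey p.rowWord := by
  obtain ⟨s, hs, e⟩ := exists_of_polytabloid_ne_zero h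
  rcases eq_or_ne s 1 with rfl | h1
  · exact Or.inl (hp.eq_of_rowWord_eq hq e.symm)
  · exact Or.inr (by rw [e]; exact hp.wordKey_comp_lt hs h1)

end Filling

/-- A family of integral functions with unitriangular leading coefficients: divisibility of a
combination forces divisibility of its coefficients. -/
theorem dvd_coeff_of_unitriangular {ι α κ : Type*} [LinearOrder κ] (e : ι → α → ℤ) (top : ι → α)
    (key : ι → κ) (h1 : ∀ i, e i (top i) = 1)
    (h2 : ∀ i j, e i (top j) ≠ 0 → i = j ∨ key j < key i)
    (s : Finset ι) (c : ι → ℤ) (k : ℤ) (x : α → ℤ) (hx : k • x = ∑ i ∈ s, c i • e i) :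
    ∀ i ∈ s, k ∣ c i := by
  classical
  by_contra! hc
  obtain ⟨i0, hi0, hk0⟩ := hc
  -- Take a bad coefficient of maximal key and evaluate at `top i`: any other surviving term has a
  -- larger key, so its coefficient is divisible by `k`.
  obtain ⟨i, hi, hmax⟩ := Finset.exists_max_image (s.filter fun i => ¬ k ∣ c i) key
    ⟨i0, by simp [hi0, hk0]⟩
  rw [Finset.mem_filter] at hi
  apply hi.2
  have := congrFun hx (top i)
  rw [Finset.sum_apply, ← Finset.add_sum_erase _ _ hi.1] at this
  simp only [Pi.smul_apply, smul_eq_mul, h1, mul_one] at this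
  rw [← sub_eq_iff_eq_add] at this
  rw [← this]
  refine dvd_sub (dvd_mul_right _ _) (Finset.dvd_sum fun j hj => ?_)
  rw [Finset.mem_erase] at hj
  by_cases h0 : e j (top i) = 0
  · simp [h0]
  rcases h2 j i h0 with e | e
  · exact absurd e hj.1
  · by_contra hd
    exact absurd (hmax j (by simpa [hj.2] using fun hh => hd (hh.mul_right _))) (not_le.2 e)

namespace Filling

variable {n : ℕ} {lam : YoungDiagram}

/-- The `ℤ`-span of the standard polytabloids. -/
def standardSpan (lam : YoungDiagram) (n : ℕ) : Submodule ℤ (WordModule n) :=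
  Submodule.span ℤ (Set.range fun p : {p : Filling n // IsStandard lam p} => p.1.polytabloid)

/-- The case `k = 0` yields linear independence, the case `k ≠ 0` purity. -/
theorem dvd_coeff_of_standard (s : Finset {p : Filling n // IsStandard lam p})
    (c : {p : Filling n // IsStandard lam p} → ℤ) (k : ℤ) (x : WordModule n)
    (hx : k • x = ∑ i ∈ s, c i • i.1.polytabloid) : ∀ i ∈ s, k ∣ c i :=
  dvd_coeff_of_unitriangular (fun i : {p : Filling n // IsStandard lam p} => i.1.polytabloid)
    (fun i => i.1.rowWord) (fun i => wordKey i.1.rowWord) (fun i => i.2.polytabloid_self)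
    (fun i j h => (i.2.wordKey_lt_of_ne_zero j.2 h).imp (Subtype.ext) id) s c k x hx

theorem linearIndependent_standard (lam : YoungDiagram) (n : ℕ) :
    LinearIndependent ℤ fun p : {p : Filling n // IsStandard lam p} => p.1.polytabloid := by
  rw [linearIndependent_iff']
  intro s g hg i hi
  exact zero_dvd_iff.1 (dvd_coeff_of_standard s g 0 0 (by rw [hg, zero_smul]) i hi)

/-- The span of the standard polytabloids is a pure sublattice. -/
theorem mem_standardSpan_of_smul_mem {k : ℤ} (hk : k ≠ 0) {x : WordModule n}
    (h : k • x ∈ standardSpan lam n) : x ∈ standardSpan lam n := by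
  rw [standardSpan, Finsupp.mem_span_range_iff_exists_finsupp] at h
  obtain ⟨c, hc⟩ := h
  have hd := dvd_coeff_of_standard c.support c k x hc.symm
  choose! d hd using hd
  have : x = ∑ i ∈ c.support, d i • i.1.polytabloid := by
    apply smul_right_injective _ hk
    simp only
    rw [← hc, Finset.smul_sum, Finsupp.sum]
    exact Finset.sum_congr rfl fun i hi => by rw [hd i hi, smul_smul]
  rw [this]
  exact Submodule.sum_mem _ fun i _ => Submodule.smul_mem _ _ (Submodule.subset_span ⟨i, rfl⟩)

end Filling

/-! ### Garnir relations and straightening. -/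

/-- If a permutation moves part of `Y` to elements larger than all of `Y`, it increases the sum of `Y`. -/
theorem sum_lt_sum_perm {n : ℕ} (Y : Finset (Fin n)) (g : Perm (Fin n)) (b : Fin n)
    (hY : ∀ z ∈ Y, z < b) (hg : ∀ z ∈ Y, g z ∈ Y ∨ b ≤ g z) (hne : ∃ z ∈ Y, g z ∉ Y) :
    ∑ z ∈ Y, (z : ℕ) < ∑ z ∈ Y, (g z : ℕ) := by
  classical
  have e : ∑ z ∈ Y, (g z : ℕ) = ∑ z ∈ Y.map g.toEmbedding, (z : ℕ) := by simp
  rw [e]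
  set Z := Y.map g.toEmbedding
  -- The two differences have equal size; elements of the first are below `b`, those of the second
  -- at least `b`.
  have hcard : (Y \ Z).card = (Z \ Y).card :=
    Finset.card_sdiff_comm (Finset.card_map _).symm
  have hZ : ∀ w ∈ Z \ Y, (b : ℕ) ≤ w := by
    intro w hw
    obtain ⟨h1, h2⟩ := Finset.mem_sdiff.1 hw
    obtain ⟨z, hz, rfl⟩ := Finset.mem_map.1 h1
    exact (hg z hz).resolve_left h2
  have hpos : 0 < (Z \ Y).card := by
    obtain ⟨z, hz, hz'⟩ := hne
    exact Finset.card_pos.2 ⟨g z, Finset.mem_sdiff.2 ⟨Finset.mem_map.2 ⟨z, hz, rfl⟩, hz'⟩⟩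
  rw [← Finset.sum_inter_add_sum_sdiff Y Z, ← Finset.sum_inter_add_sum_sdiff Z Y,
    Finset.inter_comm Z Y]
  refine Nat.add_lt_add_left ?_ _
  calc ∑ z ∈ Y \ Z, (z : ℕ) < ∑ z ∈ Y \ Z, (b : ℕ) := by
        refine Finset.sum_lt_sum_of_nonempty (Finset.card_pos.1 (hcard ▸ hpos)) fun z hz => ?_
        exact hY z (Finset.mem_sdiff.1 hz).1
    _ = ∑ z ∈ Z \ Y, (b : ℕ) := by simp [hcard]
    _ ≤ _ := Finset.sum_le_sum hZ

namespace Filling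

variable {n : ℕ} {lam : YoungDiagram} {p q : Filling n}

/-- The permutations of a set of symbols. -/
def symStab (Z : Finset (Fin n)) : Subgroup (Perm (Fin n)) :=
  fixingSubgroup (Perm (Fin n)) ((Z : Set (Fin n))ᶜ)

theorem mem_symStab {Z : Finset (Fin n)} {g : Perm (Fin n)} :
    g ∈ symStab Z ↔ ∀ x ∉ Z, g x = x := by
  simp [symStab, mem_fixingSubgroup_iff]

theorem mem_of_mem_symStab {Z : Finset (Fin n)} {g : Perm (Fin n)} (hg : g ∈ symStab Z) {x : Fin n}
    (hx : x ∈ Z) : g x ∈ Z := by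
  by_contra h
  have := mem_symStab.1 hg _ h
  rw [g.injective this] at h
  exact h hx

open scoped Classical in
theorem sum_symStab_wordDelta {Z : Finset (Fin n)} {w : Fin n → Option ℕ} {x y : Fin n} (hx : x ∈ Z)
    (hy : y ∈ Z) (hxy : x ≠ y) (hw : w x = w y) :
    ∑ g : symStab Z, (Perm.sign g.1 : ℤ) • wordRep n g.1 (wordDelta w) = 0 := by
  have hs : swap x y ∈ symStab Z := mem_symStab.2 fun z hz =>
    swap_apply_of_ne_of_ne (fun e => hz (e ▸ hx)) (fun e => hz (e ▸ hy))
  have hfix : wordRep n (swap x y) (wordDelta w) = wordDelta w := by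
    rw [wordRep_wordDelta]
    congr 1
    ext1 z
    rw [swap_inv]
    rcases eq_or_ne z x with rfl | hzx
    · simp [hw]
    rcases eq_or_ne z y with rfl | hzy
    · simp [hw]
    simp [swap_apply_of_ne_of_ne hzx hzy]
  set A := ∑ g : symStab Z, (Perm.sign g.1 : ℤ) • wordRep n g.1 (wordDelta w) with hA
  have h1 : A = -A := by
    conv_lhs => rw [hA, ← Equiv.sum_comp (Equiv.mulRight (⟨_, hs⟩ : symStab Z))]
    rw [hA, ← Finset.sum_neg_distrib]
    refine Finset.sum_congr rfl fun g _ => ?_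
    rw [Equiv.coe_mulRight, Subgroup.coe_mul, map_mul, map_mul, Module.End.mul_apply, hfix,
      Perm.sign_swap hxy]
    simp
  exact self_eq_neg.1 h1

open scoped Classical in
/-- The Garnir relation. -/
theorem sum_symStab_polytabloid (hp : IsTableau lam p) {Z : Finset (Fin n)} {j : ℕ}
    (hZ : ∀ z ∈ Z, ∃ c, p z = some c ∧ j ≤ c.2) (hcard : lam.colLen j < Z.card) :
    ∑ g : symStab Z, (Perm.sign g.1 : ℤ) • wordRep n g.1 p.polytabloid = 0 := by
  simp only [polytabloid, antisym_eq, map_sum, Finset.smul_sum]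
  rw [Finset.sum_comm]
  refine Finset.sum_eq_zero fun s _ => ?_
  -- After a column permutation the letter at `z` is the row of a box in the column of `z`, hence
  -- less than `colLen j`. As `Z` is larger than that, a letter repeats on `Z`, and the alternating
  -- sum kills every term of the polytabloid.
  have hmap : ∀ z ∈ Z, ((p.rowWord ∘ ⇑s.1⁻¹) z).getD 0 ∈ Finset.range (lam.colLen j) ∧
      (p.rowWord ∘ ⇑s.1⁻¹) z ≠ none := by
    intro z hz
    obtain ⟨c, hc, hj⟩ := hZ z hz
    have h1 := ((inv_mem s.2 : s.1⁻¹ ∈ p.colStab) z).1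
    rw [hc, Option.map_some, Option.map_eq_some_iff] at h1
    obtain ⟨d, hd, e⟩ := h1
    rw [Function.comp, rowWord_of_eq_some hd]
    have hd' : (d.1, d.2) ∈ lam := (hp.mem_iff _).2 ⟨_, hd⟩
    rw [YoungDiagram.mem_iff_lt_colLen] at hd'
    simpa using hd'.trans_le (lam.colLen_anti _ _ (e ▸ hj))
  obtain ⟨x, hx, y, hy, hxy, he⟩ := Finset.exists_ne_map_eq_of_card_lt_of_maps_to
    (t := Finset.range (lam.colLen j)) (by simpa using hcard) (fun z hz => (hmap z hz).1)
  have hw : (p.rowWord ∘ ⇑s.1⁻¹) x = (p.rowWord ∘ ⇑s.1⁻¹) y := by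
    obtain ⟨a, ha⟩ := Option.ne_none_iff_exists'.1 (hmap x hx).2
    obtain ⟨b, hb⟩ := Option.ne_none_iff_exists'.1 (hmap y hy).2
    rw [ha, hb] at he ⊢
    simpa using he
  have := sum_symStab_wordDelta hx hy hxy hw
  rw [← smul_zero ((Perm.sign s.1 : ℤ)), ← this, Finset.smul_sum]
  refine Finset.sum_congr rfl fun g _ => ?_
  rw [← wordRep_wordDelta, map_smul, smul_comm]

theorem finite_setOf_isTableau (lam : YoungDiagram) (n : ℕ) :
    {p : Filling n | IsTableau lam p}.Finite := by
  refine (Set.Finite.pi' (fun _ : Fin n =>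
    (lam.cells.finite_toSet.image some).insert none)).subset fun p hp x => ?_
  cases h : p x with
  | none => simp
  | some c => simpa using (hp.mem_iff c).2 ⟨x, h⟩

/-- Straightening: all polytabloids are combinations of the standard ones. -/
theorem IsTableau.polytabloid_mem (hp : IsTableau lam p) :
    p.polytabloid ∈ standardSpan lam n := by
  classical
  by_contra hbad
  let col : Filling n → Fin n → ℕ := fun p x => ((p x).map Prod.snd).getD 0
  let row : Filling n → Fin n → ℕ := fun p x => ((p x).map Prod.fst).getD 0
  -- A counterexample with (`m1`, `m2`) lexicographically maximal is chosen. Sorting a column keeps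
  -- `m1` and raises `m2`; the new terms of a Garnir relation raise `m1`.
  let m1 : Filling n → ℕ := fun p => ∑ x : Fin n, (x : ℕ) * col p x
  let m2 : Filling n → ℕ := fun p => ∑ x : Fin n, (x : ℕ) * row p x
  have hcomp : ∀ (f : Fin n → ℕ) (g : Perm (Fin n)),
      ∑ x : Fin n, (x : ℕ) * f (g x) = ∑ x : Fin n, ((g⁻¹ x : Fin n) : ℕ) * f x := fun f g => by
    rw [← Equiv.sum_comp g (fun x => ((g⁻¹ x : Fin n) : ℕ) * f x)]; simp
  obtain ⟨p, ⟨hp, hbad⟩, hmax⟩ := Set.exists_max_image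
    {p : Filling n | IsTableau lam p ∧ p.polytabloid ∉ standardSpan lam n}
    (fun p => toLex (m1 p, m2 p)) ((finite_setOf_isTableau lam n).subset fun p hp => hp.1)
    ⟨p, hp, hbad⟩
  have hgood : ∀ q, IsTableau lam q → (m1 p < m1 q ∨ m1 p = m1 q ∧ m2 p < m2 q) →
      q.polytabloid ∈ standardSpan lam n := by
    intro q hq h
    by_contra hc
    exact absurd (hmax q ⟨hq, hc⟩) (not_le.2 (Prod.Lex.toLex_lt_toLex.2 h))
  have hcol : ∀ x y c d, p x = some c → p y = some d → c.2 = d.2 → c.1 < d.1 → x < y := by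
    intro x y c d hx hy h2 h1
    have hne : x ≠ y := by
      rintro rfl
      rw [hx, Option.some.injEq] at hy
      rw [hy] at h1
      exact lt_irrefl _ h1
    by_contra hc
    have hlt : y < x := lt_of_le_of_ne (not_lt.1 hc) hne.symm
    have hs := swap_mem_colStab hx hy h2
    have e1 := polytabloid_comp_of_mem_colStab hs
    have hq := hgood (p ∘ swap x y) (hp.comp _) (Or.inr ⟨?_, ?_⟩)
    · rw [e1, Perm.sign_swap hne] at hq
      exact hbad (by simpa using hq)
    · refine Finset.sum_congr rfl fun z _ => ?_
      simp only [col, Function.comp, (hs z).1]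
    · change _ < ∑ z : Fin n, (z : ℕ) * row p (swap x y z)
      simp only [m2]
      have hy' : y ∈ Finset.univ.erase x := by simp [hne.symm]
      rw [← Finset.add_sum_erase _ _ (Finset.mem_univ x), ← Finset.add_sum_erase _ _ hy',
        ← Finset.add_sum_erase Finset.univ (fun z : Fin n => (z : ℕ) * row p (swap x y z))
          (Finset.mem_univ x), ← Finset.add_sum_erase _ _ hy', ← add_assoc, ← add_assoc]
      have hrest : ∀ z ∈ (Finset.univ.erase x).erase y,
          (z : ℕ) * row p z = (z : ℕ) * row p (swap x y z) := by
        intro z hz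
        simp only [Finset.mem_erase] at hz
        rw [swap_apply_of_ne_of_ne hz.2.1 hz.1]
      rw [Finset.sum_congr rfl hrest, swap_apply_left, swap_apply_right]
      refine Nat.add_lt_add_right ?_ _
      have ex : row p x = c.1 := by simp [row, hx]
      have ey : row p y = d.1 := by simp [row, hy]
      have hlt' : (y : ℕ) < x := hlt
      rw [ex, ey]
      nlinarith
  have hrow : ∀ x y i j, p x = some (i, j) → p y = some (i, j + 1) → x < y := by
    intro x y i j hx hy
    by_contra hc
    have hne : y ≠ x := by
      rintro rfl
      rw [hx] at hy
      simp at hy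
    have hlt : y < x := lt_of_le_of_ne (not_lt.1 hc) hne
    have hij : (i, j) ∈ lam := (hp.mem_iff _).2 ⟨x, hx⟩
    have hij' : (i, j + 1) ∈ lam := (hp.mem_iff _).2 ⟨y, hy⟩
    have hsym : ∀ c, ∃ z, c ∈ lam → p z = some c := fun c => by
      by_cases h : c ∈ lam
      · obtain ⟨z, hz⟩ := (hp.mem_iff c).1 h
        exact ⟨z, fun _ => hz⟩
      · exact ⟨x, fun h' => absurd h' h⟩
    choose sym hsym using hsym
    -- The Garnir set of the descent: column `j` from row `i` down and column `j + 1` down to row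
    -- `i`, altogether `colLen j + 1` boxes. The symbols in `CX` are at least `x`, those in `CY` at
    -- most `y < x`.
    let CX : Finset (ℕ × ℕ) := Finset.Ico i (lam.colLen j) ×ˢ {j}
    let CY : Finset (ℕ × ℕ) := Finset.range (i + 1) ×ˢ {j + 1}
    have hCX : ∀ c ∈ CX, c ∈ lam := by
      rintro ⟨a, b⟩ h
      simp only [CX, Finset.mem_product, Finset.mem_Ico, Finset.mem_singleton] at h
      rw [h.2, YoungDiagram.mem_iff_lt_colLen]
      exact h.1.2
    have hCY : ∀ c ∈ CY, c ∈ lam := by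
      rintro ⟨a, b⟩ h
      simp only [CY, Finset.mem_product, Finset.mem_range, Finset.mem_singleton] at h
      rw [h.2]
      exact lam.up_left_mem (by omega) le_rfl hij'
    have hCU : ∀ c ∈ CX ∪ CY, c ∈ lam := fun c hc =>
      (Finset.mem_union.1 hc).elim (hCX c) (hCY c)
    have hinj : Set.InjOn sym (CX ∪ CY : Finset (ℕ × ℕ)) := by
      intro c hc d hd e
      have h1 := hsym c (hCU c hc)
      rw [e, hsym d (hCU d hd)] at h1
      simpa using h1.symm
    let Z := (CX ∪ CY).image sym
    let Y := CY.image sym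
    have hdisj : Disjoint CX CY := by
      rw [Finset.disjoint_left]
      rintro ⟨a, b⟩ h h'
      simp [CX, CY] at h h'
      omega
    have hcard : lam.colLen j < Z.card := by
      have := YoungDiagram.mem_iff_lt_colLen.1 hij
      rw [Finset.card_image_of_injOn hinj, Finset.card_union_of_disjoint hdisj]
      simp [CX, CY]
      omega
    have hZ : ∀ z ∈ Z, (z ∈ Y ∧ ∃ a ≤ i, p z = some (a, j + 1)) ∨
        (z ∉ Y ∧ x ≤ z ∧ ∃ a, p z = some (a, j)) := by
      intro z hz
      obtain ⟨⟨a, b⟩, hab, rfl⟩ := Finset.mem_image.1 hz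
      have hs := hsym _ (hCU _ hab)
      rcases Finset.mem_union.1 hab with h | h
      · right
        refine ⟨fun hY => ?_, ?_, ?_⟩
        · obtain ⟨c, hc, e⟩ := Finset.mem_image.1 hY
          have := hinj (Finset.mem_coe.2 (Finset.mem_union_right _ hc)) (Finset.mem_coe.2 hab) e
          rw [this] at hc
          exact Finset.disjoint_left.1 hdisj h hc
        · simp only [CX, Finset.mem_product, Finset.mem_Ico, Finset.mem_singleton] at h
          rcases h.1.1.eq_or_lt with h0 | h0
          · rw [hp.inj x _ _ hx (by rw [hs, h0, h.2])]
          · exact (hcol _ _ _ _ hx hs h.2.symm h0).le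
        · simp only [CX, Finset.mem_product, Finset.mem_Ico, Finset.mem_singleton] at h
          exact ⟨a, by rw [hs, h.2]⟩
      · left
        refine ⟨Finset.mem_image_of_mem _ h, ?_⟩
        simp only [CY, Finset.mem_product, Finset.mem_range, Finset.mem_singleton] at h
        exact ⟨a, by omega, by rw [hs, h.2]⟩
    have hYZ : Y ⊆ Z := Finset.image_subset_image Finset.subset_union_right
    have hY : ∀ z ∈ Y, z < x ∧ ∃ a, p z = some (a, j + 1) := by
      intro z hz
      rcases hZ z (hYZ hz) with ⟨-, a, ha, hpz⟩ | h
      · refine ⟨lt_of_le_of_lt ?_ hlt, a, hpz⟩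
        rcases ha.eq_or_lt with h0 | h0
        · rw [hp.inj z _ _ hpz (by rw [hy, h0])]
        · exact (hcol _ _ _ _ hpz hy rfl h0).le
      · exact absurd hz h.1
    -- A permutation of `Z` preserving `Y` also preserves `Z \ Y`, hence both columns; any other one
    -- moves part of `Y` up to symbols at least `x`.
    have hstab : ∀ g ∈ symStab Z, (∀ z ∈ Y, g z ∈ Y) → g ∈ p.colStab := by
      intro g hg hgY
      have himg : Y.image g = Y := Finset.eq_of_subset_of_card_le
        (Finset.image_subset_iff.2 hgY) (by rw [Finset.card_image_of_injective _ g.injective])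
      intro z
      by_cases hz : z ∈ Z
      · have hgz := mem_of_mem_symStab hg hz
        by_cases hzY : z ∈ Y
        · obtain ⟨a, ha⟩ := (hY z hzY).2
          obtain ⟨b, hb⟩ := (hY _ (hgY z hzY)).2
          simp [ha, hb]
        · have hgzY : g z ∉ Y := fun h => by
            rw [← himg, Finset.mem_image] at h
            obtain ⟨z', hz', e⟩ := h
            exact hzY (g.injective e ▸ hz')
          obtain ⟨-, -, a, ha⟩ := (hZ z hz).resolve_left fun h => hzY h.1
          obtain ⟨-, -, b, hb⟩ := (hZ _ hgz).resolve_left fun h => hgzY h.1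
          simp [ha, hb]
      · rw [mem_symStab.1 hg z hz]; simp
    have hup : ∀ g ∈ symStab Z, g ∉ p.colStab →
        polytabloid (p ∘ ⇑g⁻¹) ∈ standardSpan lam n := by
      intro g hg hgC
      refine hgood _ (hp.comp _) (Or.inl ?_)
      have e1 : m1 (p ∘ ⇑g⁻¹) = ∑ z : Fin n, ((g z : Fin n) : ℕ) * col p z := by
        have := hcomp (col p) g⁻¹
        rw [inv_inv] at this
        exact this
      have hlt := sum_lt_sum_perm Y g x (fun z hz => (hY z hz).1) (fun z hz => by
        rcases hZ _ (mem_of_mem_symStab hg (hYZ hz)) with h | h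
        · exact Or.inl h.1
        · exact Or.inr h.2.1) (by
          by_contra! h
          exact hgC (hstab g hg h))
      -- On `Z` the column is `j`, plus one on `Y`. The displacements of a permutation sum to zero,
      -- so the change of `m1` is the change of the sum over `Y`.
      have e2 : ∀ z : Fin n, ((g z : Fin n) : ℤ) * col p z - (z : ℕ) * col p z
          = j * (((g z : Fin n) : ℤ) - (z : ℕ)) +
            if z ∈ Y then (((g z : Fin n) : ℤ) - (z : ℕ)) else 0 := by
        intro z
        by_cases hz : z ∈ Z
        · rcases hZ z hz with ⟨hzY, a, -, ha⟩ | ⟨hzY, -, a, ha⟩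
          · have : col p z = j + 1 := by simp [col, ha]
            rw [this, if_pos hzY]; push_cast; ring
          · have : col p z = j := by simp [col, ha]
            rw [this, if_neg hzY]; ring
        · rw [mem_symStab.1 hg z hz]; simp
      have e3 : ∑ z : Fin n, (((g z : Fin n) : ℤ) - (z : ℕ)) = 0 := by
        rw [Finset.sum_sub_distrib, Equiv.sum_comp g (fun z : Fin n => ((z : ℕ) : ℤ)), sub_self]
      have e4 : (m1 (p ∘ ⇑g⁻¹) : ℤ) - m1 p = ∑ z ∈ Y, (((g z : Fin n) : ℤ) - (z : ℕ)) := by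
        rw [e1]
        simp only [m1]
        push_cast
        rw [← Finset.sum_sub_distrib, Finset.sum_congr rfl fun z _ => e2 z, Finset.sum_add_distrib,
          ← Finset.mul_sum, e3, mul_zero, zero_add, Finset.sum_ite_mem, Finset.univ_inter]
      rw [Finset.sum_sub_distrib] at e4
      zify
      zify at hlt
      linarith
    have hG := sum_symStab_polytabloid hp (Z := Z) (j := j) (fun z hz => by
      rcases hZ z hz with ⟨-, a, -, ha⟩ | ⟨-, -, a, ha⟩
      · exact ⟨_, ha, Nat.le_succ j⟩
      · exact ⟨_, ha, le_rfl⟩) hcard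
    rw [← Finset.sum_filter_add_sum_filter_not _ (fun g : symStab Z => g.1 ∈ p.colStab)] at hG
    have h1 : ∑ g : symStab Z with g.1 ∈ p.colStab,
        (Perm.sign g.1 : ℤ) • wordRep n g.1 p.polytabloid =
        ((Finset.univ.filter fun g : symStab Z => g.1 ∈ p.colStab).card : ℤ) • p.polytabloid := by
      rw [natCast_zsmul, ← Finset.sum_const]
      refine Finset.sum_congr rfl fun g hg => ?_
      rw [polytabloid, wordRep_antisym (Finset.mem_filter.1 hg).2, smul_smul]
      rcases Int.units_eq_one_or (Perm.sign g.1) with h | h <;> simp [h]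
    rw [h1] at hG
    apply hbad
    -- The sum runs over the whole group instead of coset representatives, so the relation only
    -- reaches a positive multiple of the polytabloid. Purity removes the factor.
    refine mem_standardSpan_of_smul_mem (k := (Finset.univ.filter
      fun g : symStab Z => g.1 ∈ p.colStab).card) ?_ ?_
    · exact_mod_cast (Finset.card_pos.2 ⟨1, by simp [one_mem]⟩).ne'
    · rw [eq_neg_of_add_eq_zero_left hG]
      refine neg_mem (Submodule.sum_mem _ fun g hg => Submodule.smul_mem _ _ ?_)
      rw [wordRep_polytabloid]
      exact hup g.1 g.2 (Finset.mem_filter.1 hg).2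
  have hrow' : ∀ k x y i j, p x = some (i, j) → p y = some (i, j + k) → x ≤ y := by
    intro k
    induction k with
    | zero => exact fun x y i j hx hy => (hp.inj x y _ hx hy).le
    | succ k ih =>
      intro x y i j hx hy
      obtain ⟨z, hz⟩ := (hp.mem_iff (i, j + k)).1
        (lam.up_left_mem le_rfl (by omega) ((hp.mem_iff _).2 ⟨y, hy⟩))
      exact (ih x z i j hx hz).trans (hrow z y i (j + k) hz hy).le
  refine hbad (Submodule.subset_span ⟨⟨p, hp.mem_iff, ?_⟩, rfl⟩)
  rintro x y ⟨a, b⟩ ⟨a', b'⟩ hx hy ⟨h1, h2⟩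
  simp only at h1 h2
  obtain ⟨k, rfl⟩ := Nat.exists_eq_add_of_le h2
  obtain ⟨z, hz⟩ := (hp.mem_iff (a, b + k)).1
    (lam.up_left_mem h1 le_rfl ((hp.mem_iff _).2 ⟨y, hy⟩))
  refine (hrow' k x z a b hx hz).trans ?_
  rcases h1.eq_or_lt with rfl | h1
  · exact (hp.inj _ _ _ hz hy).le
  · exact (hcol _ _ _ _ hz hy rfl h1).le

end Filling

/-! ### Diagrams as row length functions, adding boxes, interlacing. -/

namespace YoungDiagram

theorem ext_rowLen {mu nu : YoungDiagram} (h : ∀ i, mu.rowLen i = nu.rowLen i) : mu = nu := by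
  ext ⟨i, j⟩
  rw [mem_cells, mem_cells, mem_iff_lt_rowLen, mem_iff_lt_rowLen, h]

theorem exists_rowLen_eq (f : ℕ → ℕ) (hf : Antitone f) {N : ℕ} (hN : f N = 0) :
    ∃ nu : YoungDiagram, nu.rowLen = f := by
  let nu : YoungDiagram :=
    { cells := (Finset.range N ×ˢ Finset.range (f 0)).filter fun c => c.2 < f c.1
      isLowerSet := by
        rintro ⟨a, b⟩ ⟨a', b'⟩ ⟨h1, h2⟩ h
        simp only [Finset.coe_filter, Finset.mem_product, Finset.mem_range, Set.mem_ofPred_eq] at h ⊢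
        simp only at h1 h2
        have := hf h1
        exact ⟨⟨by omega, by omega⟩, by omega⟩ }
  have hmem : ∀ i j, (i, j) ∈ nu ↔ j < f i := by
    intro i j
    rw [← mem_cells]
    simp only [nu, Finset.mem_filter, Finset.mem_product, Finset.mem_range, and_iff_right_iff_imp]
    intro h
    refine ⟨?_, h.trans_le (hf (Nat.zero_le i))⟩
    by_contra hc
    have := hf (not_lt.1 hc)
    omega
  refine ⟨nu, funext fun i => ?_⟩
  refine le_antisymm ?_ ?_
  · by_contra hc
    have := (hmem i (f i)).1 (mem_iff_lt_rowLen.2 (not_le.1 hc))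
    exact lt_irrefl _ this
  · by_contra hc
    have := mem_iff_lt_rowLen.1 ((hmem i (nu.rowLen i)).2 (not_le.1 hc))
    exact lt_irrefl _ this

theorem mem_card_bounds {lam : YoungDiagram} {c : ℕ × ℕ} (h : c ∈ lam) :
    c.1 < lam.card ∧ c.2 < lam.card := by
  have h1 : lam.rowLen c.1 ≤ lam.card := by
    rw [rowLen_eq_card]; exact Finset.card_le_card (Finset.filter_subset _ _)
  have h2 : lam.colLen c.2 ≤ lam.card := by
    rw [colLen_eq_card]; exact Finset.card_le_card (Finset.filter_subset _ _)
  exact ⟨(mem_iff_lt_colLen.1 (show (c.1, c.2) ∈ lam from h)).trans_le h2,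
    (mem_iff_lt_rowLen.1 (show (c.1, c.2) ∈ lam from h)).trans_le h1⟩

theorem rowLen_card (lam : YoungDiagram) : lam.rowLen lam.card = 0 := by
  by_contra hc
  exact lt_irrefl _ (mem_card_bounds (mem_iff_lt_rowLen.2 (Nat.pos_of_ne_zero hc))).1

theorem finite_setOf_card_eq (n : ℕ) : {lam : YoungDiagram | lam.card = n}.Finite := by
  refine Set.Finite.of_finite_image (f := YoungDiagram.cells)
    ((Finset.finite_toSet (Finset.range n ×ˢ Finset.range n).powerset).subset ?_)
    fun a _ b _ h => YoungDiagram.ext h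
  rintro _ ⟨lam, rfl, rfl⟩
  simp only [Finset.mem_coe, Finset.mem_powerset]
  intro c hc
  have := mem_card_bounds (mem_cells _ |>.1 hc)
  simpa using this

/-- All diagrams with `n` boxes. -/
def ofCard (n : ℕ) : Finset YoungDiagram := (finite_setOf_card_eq n).toFinset

@[simp] theorem mem_ofCard {n : ℕ} {lam : YoungDiagram} : lam ∈ ofCard n ↔ lam.card = n := by
  simp [ofCard]

/-- `lam` arises from `mu` by adding a box. -/
def AddBox (mu lam : YoungDiagram) : Prop := ∃ c, c ∉ mu ∧ ∀ d, d ∈ lam ↔ d = c ∨ d ∈ mu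

theorem AddBox.card {mu lam : YoungDiagram} (h : AddBox mu lam) : lam.card = mu.card + 1 := by
  obtain ⟨c, hc, hd⟩ := h
  have : lam.cells = insert c mu.cells := by
    ext d; rw [Finset.mem_insert, mem_cells, mem_cells, hd]
  rw [YoungDiagram.card, this, Finset.card_insert_of_notMem (by simpa using hc)]

theorem addBox_iff {mu lam : YoungDiagram} :
    AddBox mu lam ↔ ∃ i, ∀ j, lam.rowLen j = mu.rowLen j + if j = i then 1 else 0 := by
  constructor
  · rintro ⟨⟨i, b⟩, hc, hd⟩
    rw [mem_iff_lt_rowLen] at hc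
    have key : ∀ j k, k < lam.rowLen j ↔ (j = i ∧ k = b) ∨ k < mu.rowLen j := by
      intro j k
      have := hd (j, k)
      rwa [mem_iff_lt_rowLen, mem_iff_lt_rowLen, Prod.mk.injEq] at this
    refine ⟨i, fun j => ?_⟩
    have h1 := key j (mu.rowLen j)
    have h2 := key j b
    have h3 := key j (mu.rowLen j + 1)
    have h4 := key j (lam.rowLen j)
    have h5 := key j (mu.rowLen j - 1)
    split_ifs with h
    · subst h
      simp only [true_and, lt_irrefl, or_false, true_or, iff_true] at h1 h2 h3 h4 h5
      omega
    · simp only [h, false_and, false_or] at h1 h2 h3 h4 h5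
      omega
  · rintro ⟨i, hi⟩
    refine ⟨(i, mu.rowLen i), by simp [mem_iff_lt_rowLen], ?_⟩
    rintro ⟨j, k⟩
    rw [mem_iff_lt_rowLen, mem_iff_lt_rowLen, hi, Prod.mk.injEq]
    split_ifs with h
    · subst h; simp; omega
    · simp [h]

open scoped Classical in
/-- The diagrams obtained by removing a box. -/
def removals (lam : YoungDiagram) : Finset YoungDiagram :=
  (ofCard (lam.card - 1)).filter fun mu => AddBox mu lam

@[simp] theorem mem_removals {lam mu : YoungDiagram} : mu ∈ removals lam ↔ AddBox mu lam := by
  simp only [removals, Finset.mem_filter, mem_ofCard, and_iff_right_iff_imp]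
  intro h
  rw [h.card]; rfl

/-- Reduces counting diagrams to counting the rows in which a box is added or removed. -/
theorem ncard_setOf_rowLen (P : Set ℕ) (g : ℕ → ℕ → ℕ) (hinj : Set.InjOn g P)
    (hex : ∀ i ∈ P, ∃ nu : YoungDiagram, nu.rowLen = g i) :
    {nu : YoungDiagram | ∃ i ∈ P, nu.rowLen = g i}.ncard = P.ncard := by
  choose! F hF using hex
  have : {nu : YoungDiagram | ∃ i ∈ P, nu.rowLen = g i} = F '' P := by
    ext nu
    constructor
    · rintro ⟨i, hi, h⟩
      exact ⟨i, hi, ext_rowLen fun j => by rw [hF i hi, h]⟩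
    · rintro ⟨i, hi, rfl⟩
      exact ⟨i, hi, hF i hi⟩
  rw [this]
  refine Set.InjOn.ncard_image fun i hi j hj e => hinj hi hj ?_
  rw [← hF i hi, ← hF j hj, e]

open scoped Classical in
/-- Adding a box above commutes with removing a box below, up to one extra possibility. -/
theorem ncard_addBox_interlaces (lam kap : YoungDiagram) :
    {nu | AddBox kap nu ∧ Interlaces lam nu}.ncard =
      (if Interlaces lam kap then 1 else 0) + {mu | AddBox mu lam ∧ Interlaces mu kap}.ncard := by
  have hl : Antitone lam.rowLen := fun a b h => lam.rowLen_anti a b h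
  have hk : Antitone kap.rowLen := fun a b h => kap.rowLen_anti a b h
  have hl0 := lam.rowLen_card
  have hk0 := kap.rowLen_card
  set l := lam.rowLen with hldef
  set k := kap.rowLen with hkdef
  -- `A` collects the rows of `kap` that may receive a box, `B` the rows of `lam` that may lose one.
  -- The interlacing inequalities already force the new row lengths to decrease weakly, and `1 ≤ l
  -- i` guards against truncated subtraction.
  let A : Set ℕ := {i | ∀ j, k (j + 1) + (if j + 1 = i then 1 else 0) ≤ l j ∧
    l j ≤ k j + if j = i then 1 else 0}
  let B : Set ℕ := {i | 1 ≤ l i ∧ ∀ j, k (j + 1) + (if j = i then 1 else 0) ≤ l j ∧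
    l j ≤ k j + if j = i then 1 else 0}
  have hA : {nu | AddBox kap nu ∧ Interlaces lam nu}.ncard = A.ncard := by
    rw [← ncard_setOf_rowLen A (fun i j => k j + if j = i then 1 else 0)]
    · congr 1
      ext nu
      simp only [Set.mem_ofPred_eq, addBox_iff, Interlaces]
      constructor
      · rintro ⟨⟨i, hi⟩, h⟩
        refine ⟨i, fun j => ?_, funext hi⟩
        have := h j
        rwa [hi, hi] at this
      · rintro ⟨i, hA, hi⟩
        refine ⟨⟨i, fun j => by rw [hi]⟩, fun j => ?_⟩
        rw [hi]
        exact hA j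
    · intro i _ i' _ e
      have := congrFun e i
      simp only [if_true] at this
      by_contra hne
      rw [if_neg hne] at this
      omega
    · intro i hi
      refine exists_rowLen_eq _ (antitone_nat_of_succ_le fun j => ?_) (N := kap.card + i + 1) ?_
      · have := hi j
        have h1 := hk (Nat.le_succ j)
        simp only [Nat.succ_eq_add_one] at h1
        split_ifs at this ⊢ <;> omega
      · have := hk (show kap.card ≤ kap.card + i + 1 by omega)
        rw [if_neg (by omega)]
        omega
  have hB : {mu | AddBox mu lam ∧ Interlaces mu kap}.ncard = B.ncard := by
    rw [← ncard_setOf_rowLen B (fun i j => l j - if j = i then 1 else 0)]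
    · congr 1
      ext mu
      simp only [Set.mem_ofPred_eq, addBox_iff, Interlaces]
      constructor
      · rintro ⟨⟨i, hi⟩, h⟩
        change ∀ j, l j = mu.rowLen j + _ at hi
        change ∀ j, k (j + 1) ≤ mu.rowLen j ∧ mu.rowLen j ≤ k j at h
        refine ⟨i, ⟨?_, fun j => ?_⟩, funext fun j => ?_⟩
        · have := hi i
          rw [if_pos rfl] at this
          omega
        · have h1 := h j
          have h2 := hi j
          split_ifs at h2 ⊢ <;> omega
        · have h2 := hi j
          split_ifs at h2 ⊢ <;> omega
      · rintro ⟨i, ⟨h1, hB⟩, hi⟩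
        replace hi : ∀ j, mu.rowLen j = l j - if j = i then 1 else 0 := congrFun hi
        refine ⟨⟨i, fun j => ?_⟩, fun j => ?_⟩
        · rw [hi]
          show l j = _
          split_ifs with h
          · subst h; omega
          · omega
        · rw [hi]
          have := hB j
          show k (j + 1) ≤ l j - _ ∧ l j - _ ≤ k j
          split_ifs at this ⊢ with h <;> omega
    · intro i hi i' _ e
      have := congrFun e i
      simp only [if_true] at this
      by_contra hne
      rw [if_neg hne] at this
      have := hi.1
      omega
    · intro i hi
      refine exists_rowLen_eq _ (antitone_nat_of_succ_le fun j => ?_) (N := lam.card) ?_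
      · have h0 := hi.2 j
        have h2 := hi.2 (j + 1)
        have h1 := hl (Nat.le_succ j)
        simp only [Nat.succ_eq_add_one] at h1
        split_ifs at h0 h2 ⊢ <;> omega
      · omega
  rw [hA, hB]
  have hBfin : B.Finite := (Set.finite_lt_nat lam.card).subset fun i hi => by
    by_contra hc
    have := hl (not_lt.1 hc)
    have := hi.1
    omega
  split_ifs with h
  -- Row `0` can always receive a box. Adding to row `i + 1` of `kap` and removing from row `i` of
  -- `lam` both amount to `k (i + 1) < l i`.
  · have e : A = insert 0 (Nat.succ '' B) := by
      ext i
      cases i with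
      | zero =>
        simp only [Set.mem_insert_iff, true_or, iff_true]
        intro j
        have := h j
        rw [if_neg (by omega)]
        exact ⟨this.1, this.2.trans (Nat.le_add_right _ _)⟩
      | succ i =>
        simp only [Set.mem_insert_iff, Nat.succ_ne_zero, false_or, Set.mem_image,
          Nat.succ_eq_add_one, add_left_inj, exists_eq_right]
        constructor
        · intro hi
          have := hi i
          rw [if_pos rfl] at this
          refine ⟨by omega, fun j => ?_⟩
          have h1 := hi j
          have h2 := h j
          simp only [add_left_inj] at h1
          exact ⟨h1.1, h2.2.trans (Nat.le_add_right _ _)⟩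
        · intro hi j
          have h1 := hi.2 j
          have h2 := h j
          simp only [add_left_inj]
          exact ⟨h1.1, h2.2.trans (Nat.le_add_right _ _)⟩
    rw [e, Set.ncard_insert_of_notMem (by simp) (hBfin.image _),
      Set.ncard_image_of_injective _ Nat.succ_injective, add_comm]
  -- Only a change in the violated row `j` can repair the interlacing, and then `l j = k j + 1`, for
  -- either set.
  · have e : A = B := by
      simp only [Interlaces, not_forall] at h
      obtain ⟨j, hj⟩ := h
      change ¬ (k (j + 1) ≤ l j ∧ l j ≤ k j) at hj
      ext i
      constructor
      · intro hi
        have h1 := hi j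
        have hji : j = i := by
          by_contra hne
          rw [if_neg hne] at h1
          exact hj ⟨by omega, by omega⟩
        subst hji
        rw [if_pos rfl] at h1
        have h2 := hk (Nat.le_succ j)
        simp only [Nat.succ_eq_add_one] at h2
        have h3 : l j = k j + 1 := by omega
        refine ⟨by omega, fun j' => ?_⟩
        have h4 := hi j'
        refine ⟨?_, h4.2⟩
        split_ifs with h5
        · subst h5; omega
        · omega
      · intro hi
        have h1 := hi.2 j
        have hji : j = i := by
          by_contra hne
          rw [if_neg hne] at h1
          exact hj ⟨by omega, by omega⟩
        subst hji
        rw [if_pos rfl] at h1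
        have h3 : l j = k j + 1 := by omega
        intro j'
        have h4 := hi.2 j'
        refine ⟨?_, h4.2⟩
        split_ifs with h5
        · subst h5
          have h2 := hl (Nat.le_succ j')
          simp only [Nat.succ_eq_add_one] at h2
          omega
        · omega
    rw [e, zero_add]

end YoungDiagram

/-! ### Counting standard fillings. -/

namespace Filling

open YoungDiagram

variable {n : ℕ} {lam : YoungDiagram}

/-- The standard fillings of `lam` by some of `n` symbols. -/
def standards (lam : YoungDiagram) (n : ℕ) : Finset (Filling n) :=
  ((finite_setOf_isTableau lam n).subset
    fun _ h => IsStandard.isTableau h : {p : Filling n | IsStandard lam p}.Finite).toFinset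

@[simp] theorem mem_standards {p : Filling n} : p ∈ standards lam n ↔ IsStandard lam p := by
  simp [standards]

theorem IsTableau.card_le {p : Filling n} (h : IsTableau lam p) : lam.card ≤ n := by
  classical
  have hsub : lam.cells.image some ⊆ Finset.univ.image p := by
    intro o ho
    obtain ⟨c, hc, rfl⟩ := Finset.mem_image.1 ho
    obtain ⟨x, hx⟩ := (h.mem_iff c).1 (by simpa using hc)
    exact Finset.mem_image.2 ⟨x, Finset.mem_univ _, hx⟩
  have := (Finset.card_le_card hsub).trans Finset.card_image_le
  rwa [Finset.card_image_of_injective _ (Option.some_injective _), Finset.card_univ,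
    Fintype.card_fin] at this

theorem isStandard_iff_init_of_none {p : Filling (n + 1)} (h : p (Fin.last n) = none) :
    IsStandard lam p ↔ IsStandard lam (p ∘ Fin.castSucc : Filling n) := by
  constructor
  · intro hp
    refine ⟨fun c => (hp.mem_iff c).trans ⟨?_, fun ⟨x, hx⟩ => ⟨_, hx⟩⟩,
      fun x y c d hx hy hcd => hp.le_of_le x.castSucc y.castSucc c d hx hy hcd⟩
    rintro ⟨x, hx⟩
    induction x using Fin.lastCases with
    | last => simp [h] at hx
    | cast x => exact ⟨x, hx⟩
  · intro hp
    refine ⟨fun c => (hp.mem_iff c).trans ⟨fun ⟨x, hx⟩ => ⟨_, hx⟩, ?_⟩, ?_⟩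
    · rintro ⟨x, hx⟩
      induction x using Fin.lastCases with
      | last => simp [h] at hx
      | cast x => exact ⟨x, hx⟩
    · intro x y c d hx hy hcd
      induction x using Fin.lastCases with
      | last => simp [h] at hx
      | cast x =>
        induction y using Fin.lastCases with
        | last => simp [h] at hy
        | cast y => exact hp.le_of_le x y c d hx hy hcd

/-- The last symbol is the largest one, so it can only occupy a removable corner. -/
theorem isStandard_iff_init_of_some {p : Filling (n + 1)} {c : ℕ × ℕ}
    (h : p (Fin.last n) = some c) :
    IsStandard lam p ↔ ∃ mu : YoungDiagram, (c ∉ mu ∧ ∀ d, d ∈ lam ↔ d = c ∨ d ∈ mu) ∧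
      IsStandard mu (p ∘ Fin.castSucc : Filling n) := by
  constructor
  · intro hp
    have hne : ∀ x : Fin n, p x.castSucc ≠ some c := fun x hx =>
      absurd (hp.isTableau.inj _ _ _ hx h) (Fin.castSucc_lt_last x).ne
    have hlow : IsLowerSet ((lam.cells.erase c : Finset (ℕ × ℕ)) : Set (ℕ × ℕ)) := by
      intro a b hba ha
      simp only [Finset.coe_erase, Set.mem_sdiff, Finset.mem_coe, mem_cells,
        Set.mem_singleton_iff] at ha ⊢
      refine ⟨lam.up_left_mem hba.1 hba.2 ha.1, ?_⟩
      rintro rfl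
      obtain ⟨y, hy⟩ := (hp.mem_iff a).1 ha.1
      have := hp.le_of_le _ _ _ _ h hy hba
      rw [Fin.last_le_iff.1 this, h] at hy
      exact ha.2 (by simpa using hy.symm)
    obtain ⟨mu, hmu⟩ : ∃ mu : YoungDiagram, ∀ d, d ∈ mu ↔ d ≠ c ∧ d ∈ lam :=
      ⟨⟨lam.cells.erase c, hlow⟩, fun d => Finset.mem_erase⟩
    refine ⟨mu, ⟨by simp [hmu], fun d => ?_⟩, ⟨fun d => ?_, ?_⟩⟩
    · rw [hmu]
      by_cases hd : d = c
      · subst hd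
        simp only [true_or, iff_true]
        exact (hp.mem_iff _).2 ⟨_, h⟩
      · simp [hd]
    · rw [hmu, hp.mem_iff]
      constructor
      · rintro ⟨hd, x, hx⟩
        induction x using Fin.lastCases with
        | last => rw [h, Option.some.injEq] at hx; exact absurd hx.symm hd
        | cast x => exact ⟨x, hx⟩
      · rintro ⟨x, hx⟩
        exact ⟨by rintro rfl; exact hne x hx, _, hx⟩
    · exact fun x y c d hx hy hcd => hp.le_of_le x.castSucc y.castSucc c d hx hy hcd
  · rintro ⟨mu, ⟨hc, hd⟩, hp⟩
    have hmem : ∀ (x : Fin n) d, p x.castSucc = some d → d ∈ mu := fun x d hx =>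
      (hp.mem_iff d).2 ⟨x, hx⟩
    refine ⟨fun d => ?_, ?_⟩
    · rw [hd]
      constructor
      · rintro (rfl | hd')
        · exact ⟨_, h⟩
        · obtain ⟨x, hx⟩ := (hp.mem_iff d).1 hd'
          exact ⟨_, hx⟩
      · rintro ⟨x, hx⟩
        induction x using Fin.lastCases with
        | last => rw [h, Option.some.injEq] at hx; exact Or.inl hx.symm
        | cast x => exact Or.inr (hmem x d hx)
    · intro x y a b hx hy hab
      induction y using Fin.lastCases with
      | last => exact Fin.le_last _
      | cast y =>
        induction x using Fin.lastCases with
        | last =>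
          rw [h, Option.some.injEq] at hx
          subst hx
          exact absurd (mu.up_left_mem hab.1 hab.2 (hmem y b hy)) hc
        | cast x => exact hp.le_of_le x y a b hx hy hab

theorem eq_of_comp_castSucc_eq {p q : Filling (n + 1)} (h : p ∘ Fin.castSucc = q ∘ Fin.castSucc)
    (hl : p (Fin.last n) = q (Fin.last n)) : p = q := by
  ext1 x
  induction x using Fin.lastCases with
  | last => exact hl
  | cast x => exact congrFun h x

/-- The last symbol is either unused or sits in a corner. In the second case the remaining filling
determines the smaller diagram, so the union over `removals` is disjoint. -/
theorem card_standards_succ (lam : YoungDiagram) (n : ℕ) :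
    (standards lam (n + 1)).card =
      (standards lam n).card + ∑ mu ∈ lam.removals, (standards mu n).card := by
  classical
  rw [← Finset.card_filter_add_card_filter_not (s := standards lam (n + 1))
    (fun p => p (Fin.last n) = none)]
  congr 1
  · refine Finset.card_nbij (fun p => p ∘ Fin.castSucc) ?_ ?_ ?_
    · intro p hp
      rw [Finset.mem_coe, Finset.mem_filter, mem_standards] at hp
      exact mem_standards.2 ((isStandard_iff_init_of_none hp.2).1 hp.1)
    · intro p hp q hq e
      rw [Finset.mem_coe, Finset.mem_filter] at hp hq
      exact eq_of_comp_castSucc_eq e (hp.2.trans hq.2.symm)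
    · intro q hq
      have e : (Fin.snoc (α := fun _ => Option (ℕ × ℕ)) q none) ∘ Fin.castSucc = q :=
        funext fun x => Fin.snoc_castSucc (α := fun _ => Option (ℕ × ℕ)) none q x
      have h0 : (Fin.snoc (α := fun _ => Option (ℕ × ℕ)) q none) (Fin.last n) = none :=
        Fin.snoc_last (α := fun _ => Option (ℕ × ℕ)) none q
      refine ⟨Fin.snoc (α := fun _ => Option (ℕ × ℕ)) q none, ?_, e⟩
      rw [Finset.mem_coe, Finset.mem_filter, mem_standards, isStandard_iff_init_of_none h0, e]
      exact ⟨mem_standards.1 hq, h0⟩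
  · rw [← Finset.card_biUnion]
    · refine Finset.card_nbij (fun p => p ∘ Fin.castSucc) ?_ ?_ ?_
      · intro p hp
        rw [Finset.mem_coe, Finset.mem_filter, mem_standards] at hp
        obtain ⟨c, hc⟩ := Option.ne_none_iff_exists'.1 hp.2
        obtain ⟨mu, h1, h2⟩ := (isStandard_iff_init_of_some hc).1 hp.1
        exact Finset.mem_biUnion.2 ⟨mu, mem_removals.2 ⟨c, h1⟩, mem_standards.2 h2⟩
      · intro p hp q hq e
        simp only [Finset.coe_filter, mem_standards, Set.mem_ofPred_eq] at hp hq
        refine eq_of_comp_castSucc_eq e ?_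
        obtain ⟨c, hc⟩ := Option.ne_none_iff_exists'.1 hp.2
        obtain ⟨y, hy⟩ := (hq.1.mem_iff c).1 ((hp.1.mem_iff c).2 ⟨_, hc⟩)
        induction y using Fin.lastCases with
        | last => rw [hc, hy]
        | cast y =>
          have := congrFun e y
          simp only [Function.comp] at this
          rw [hy] at this
          exact absurd (hp.1.isTableau.inj _ _ _ this hc) (Fin.castSucc_lt_last y).ne
      · intro q hq
        obtain ⟨mu, h1, h2⟩ := Finset.mem_biUnion.1 (Finset.mem_coe.1 hq)
        obtain ⟨c, hc⟩ := mem_removals.1 h1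
        have e : (Fin.snoc (α := fun _ => Option (ℕ × ℕ)) q (some c)) ∘ Fin.castSucc = q :=
          funext fun x => Fin.snoc_castSucc (α := fun _ => Option (ℕ × ℕ)) (some c) q x
        have h0 : (Fin.snoc (α := fun _ => Option (ℕ × ℕ)) q (some c)) (Fin.last n) = some c :=
          Fin.snoc_last (α := fun _ => Option (ℕ × ℕ)) (some c) q
        refine ⟨Fin.snoc (α := fun _ => Option (ℕ × ℕ)) q (some c), ?_, e⟩
        rw [Finset.mem_coe, Finset.mem_filter, mem_standards, isStandard_iff_init_of_some h0, e]
        exact ⟨⟨mu, hc, mem_standards.1 h2⟩, by rw [h0]; simp⟩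
    · intro mu _ mu' _ hne
      rw [Function.onFun, Finset.disjoint_left]
      intro p hp hp'
      rw [mem_standards] at hp hp'
      exact hne (YoungDiagram.ext (by ext c; rw [mem_cells, mem_cells, hp.mem_iff, hp'.mem_iff]))

open scoped Classical in
/-- The branching of numbers of standard fillings along horizontal strips. -/
theorem sum_card_standards (n : ℕ) (lam : YoungDiagram) :
    ∑ nu ∈ (ofCard n).filter (Interlaces lam), (standards nu n).card = (standards lam n).card := by
  induction n generalizing lam with
  | zero =>
    have h1 : ∀ nu : YoungDiagram, nu.card = 0 ↔ nu = ⊥ := fun nu => by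
      rw [YoungDiagram.card, Finset.card_eq_zero]
      exact ⟨fun h => YoungDiagram.ext h, fun h => by rw [h]; rfl⟩
    by_cases hlam : lam = ⊥
    · subst hlam
      have : (ofCard 0).filter (Interlaces ⊥) = {⊥} := by
        ext nu
        rw [Finset.mem_filter, mem_ofCard, h1, Finset.mem_singleton, and_iff_left_iff_imp]
        rintro rfl i
        have : (⊥ : YoungDiagram).rowLen (i + 1) ≤ (⊥ : YoungDiagram).rowLen i :=
          YoungDiagram.rowLen_anti _ _ _ (Nat.le_succ i)
        exact ⟨this, le_rfl⟩
      rw [this, Finset.sum_singleton]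
    · have h2 : standards lam 0 = ∅ := by
        rw [Finset.eq_empty_iff_forall_notMem]
        intro p hp
        have := (mem_standards.1 hp).isTableau.card_le
        exact hlam ((h1 lam).1 (Nat.le_zero.1 this))
      have : (ofCard 0).filter (Interlaces lam) = ∅ := by
        rw [Finset.filter_eq_empty_iff]
        intro nu hnu hi
        rw [mem_ofCard, h1] at hnu
        subst hnu
        apply hlam
        refine ext_rowLen fun i => le_antisymm (hi i).2 ?_
        have : (⊥ : YoungDiagram).rowLen i = 0 := by
          by_contra hc
          exact notMem_bot _ (mem_iff_lt_rowLen.2 (Nat.pos_of_ne_zero hc))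
        rw [this]; exact Nat.zero_le _
      rw [this, h2]; rfl
  | succ n ih =>
    rw [card_standards_succ, ← ih lam]
    have e1 : ∑ mu ∈ lam.removals, (standards mu n).card =
        ∑ kap ∈ ofCard n, ∑ mu ∈ lam.removals with Interlaces mu kap, (standards kap n).card := by
      rw [Finset.sum_congr rfl fun mu _ => (ih mu).symm]
      refine Finset.sum_comm' fun mu kap => ?_
      simp only [Finset.mem_filter]
      tauto
    have e2 : ∑ nu ∈ (ofCard (n + 1)).filter (Interlaces lam), (standards nu (n + 1)).card =
        ∑ kap ∈ ofCard n, ∑ nu ∈ ofCard (n + 1) with (AddBox kap nu ∧ Interlaces lam nu),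
          (standards kap n).card := by
      -- With `n + 1` boxes and only `n` symbols there is no filling, so the term in which the last
      -- symbol is unused vanishes.
      have : ∀ nu ∈ (ofCard (n + 1)).filter (Interlaces lam), (standards nu (n + 1)).card =
          ∑ kap ∈ nu.removals, (standards kap n).card := by
        intro nu hnu
        rw [Finset.mem_filter, mem_ofCard] at hnu
        rw [card_standards_succ, Nat.add_eq_right, Finset.card_eq_zero,
          Finset.eq_empty_iff_forall_notMem]
        intro p hp
        have := (mem_standards.1 hp).isTableau.card_le
        omega
      rw [Finset.sum_congr rfl this]
      refine Finset.sum_comm' fun nu kap => ?_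
      simp only [Finset.mem_filter, mem_removals, mem_ofCard]
      constructor
      · rintro ⟨⟨h1, h2⟩, h3⟩
        exact ⟨⟨h1, h3, h2⟩, by have := h3.card; omega⟩
      · rintro ⟨⟨h1, h2, h3⟩, h4⟩
        exact ⟨⟨h1, h3⟩, h2⟩
    -- Both sides are now sums over `kap` weighted by the standard fillings of `kap`; the
    -- multiplicities agree by `ncard_addBox_interlaces`.
    rw [e1, e2, Finset.sum_filter, ← Finset.sum_add_distrib]
    refine Finset.sum_congr rfl fun kap hkap => ?_
    rw [mem_ofCard] at hkap
    rw [Finset.sum_const, Finset.sum_const, smul_eq_mul, smul_eq_mul]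
    have h := ncard_addBox_interlaces lam kap
    have s1 : {nu | AddBox kap nu ∧ Interlaces lam nu} =
        ((ofCard (n + 1)).filter fun nu => AddBox kap nu ∧ Interlaces lam nu :
          Finset YoungDiagram) := by
      ext nu
      simp only [Set.mem_ofPred_eq, Finset.coe_filter, mem_ofCard]
      exact ⟨fun h => ⟨by rw [h.1.card, hkap], h⟩, fun h => h.2⟩
    have s2 : {mu | AddBox mu lam ∧ Interlaces mu kap} =
        (lam.removals.filter fun mu => Interlaces mu kap : Finset YoungDiagram) := by
      ext mu
      simp
    rw [s1, s2, Set.ncard_coe_finset, Set.ncard_coe_finset] at h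
    rw [h, add_mul]
    congr 1
    split_ifs <;> simp

end Filling

/-! ### Filling homomorphisms and strip elements. -/

/-- The word `w` has as many letters `i` as row `i` of `nu` has boxes. -/
def HasContent {n : ℕ} (nu : YoungDiagram) (w : Fin n → Option ℕ) : Prop :=
  ∀ i, (Finset.univ.filter fun x => w x = some i).card = nu.rowLen i

theorem HasContent.comp {n : ℕ} {nu : YoungDiagram} {w : Fin n → Option ℕ} (h : HasContent nu w)
    (g : Perm (Fin n)) : HasContent nu (w ∘ g) := by
  intro i
  rw [← h i]
  refine Finset.card_bij (fun x _ => g x) (fun x hx => by simpa using hx)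
    (fun x _ y _ e => g.injective e) fun y hy => ⟨g⁻¹ y, by simpa using hy, by simp⟩

theorem hasContent_comp {n : ℕ} {nu : YoungDiagram} {w : Fin n → Option ℕ} (g : Perm (Fin n)) :
    HasContent nu (w ∘ g) ↔ HasContent nu w := by
  refine ⟨fun h => ?_, fun h => h.comp g⟩
  have := h.comp g⁻¹
  rwa [Function.comp_assoc, show ⇑g ∘ ⇑g⁻¹ = id from funext fun x => by simp] at this

/-- Applied to the indicator of a proper letter, and to the row number, where the right-hand side is
`depth`. -/
theorem HasContent.sum_eq {n : ℕ} {nu : YoungDiagram} {w : Fin n → Option ℕ} (hw : HasContent nu w)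
    (h : Option ℕ → ℕ) (h0 : h none = 0) :
    ∑ x, h (w x) = ∑ i ∈ Finset.range nu.card, nu.rowLen i * h (some i) := by
  have e : ∀ x, h (w x) = ∑ i ∈ Finset.range nu.card, if w x = some i then h (some i) else 0 := by
    intro x
    cases hx : w x with
    | none => simp [h0]
    | some i =>
      have hi : i ∈ Finset.range nu.card := by
        have h1 : 0 < nu.rowLen i := by
          rw [← hw i, Finset.card_pos]
          exact ⟨x, by simpa using hx⟩
        exact Finset.mem_range.2 (YoungDiagram.mem_card_bounds
          (YoungDiagram.mem_iff_lt_rowLen.2 h1)).1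
      rw [Finset.sum_eq_single_of_mem i hi fun j _ hj => by simp [hj.symm]]
      simp
  rw [Finset.sum_congr rfl fun x _ => e x, Finset.sum_comm]
  refine Finset.sum_congr rfl fun i _ => ?_
  rw [← Finset.sum_filter, Finset.sum_const, hw i, smul_eq_mul]

theorem eq_of_hasContent {n : ℕ} {nu nu' : YoungDiagram} {w : Fin n → Option ℕ}
    (h : HasContent nu w) (h' : HasContent nu' w) : nu = nu' :=
  YoungDiagram.ext_rowLen fun i => by rw [← h i, h' i]

/-- The sum of the row numbers of the boxes. -/
def YoungDiagram.depth (nu : YoungDiagram) : ℕ := ∑ i ∈ Finset.range nu.card, nu.rowLen i * i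

/-- Erase the letters of a word at the positions in `B`. -/
def eraseAt {n : ℕ} (w : Fin n → Option ℕ) (B : Finset (Fin n)) : Fin n → Option ℕ :=
  fun x => if x ∈ B then none else w x

open scoped Classical in
/-- The homomorphism that distributes the unused symbols over the rows so as to obtain content `nu`. -/
def fillHom {n : ℕ} (nu : YoungDiagram) : WordModule n →ₗ[ℤ] WordModule n where
  toFun f w := if HasContent nu w then ∑ B : Finset (Fin n), f (eraseAt w B) else 0
  map_add' f g := by
    ext w
    by_cases h : HasContent nu w <;> simp [h, Finset.sum_add_distrib]
  map_smul' c f := by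
    ext w
    by_cases h : HasContent nu w <;> simp [h, Finset.mul_sum]

open scoped Classical in
theorem fillHom_apply {n : ℕ} (nu : YoungDiagram) (f : WordModule n) (w : Fin n → Option ℕ) :
    fillHom nu f w = if HasContent nu w then ∑ B : Finset (Fin n), f (eraseAt w B) else 0 := rfl

theorem fillHom_wordRep {n : ℕ} (nu : YoungDiagram) (g : Perm (Fin n)) (f : WordModule n) :
    fillHom nu (wordRep n g f) = wordRep n g (fillHom nu f) := by
  ext w
  rw [wordRep_apply, fillHom_apply, fillHom_apply]
  by_cases h : HasContent nu w
  swap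
  · rw [if_neg h, if_neg (fun h' => h (hasContent_comp g |>.1 h'))]
  rw [if_pos h, if_pos (h.comp g)]
  simp only [wordRep_apply]
  rw [← Equiv.sum_comp (Equiv.finsetCongr g) (fun B => f (eraseAt w B ∘ g))]
  refine Finset.sum_congr rfl fun B _ => congrArg f ?_
  ext1 x
  simp [eraseAt, Equiv.finsetCongr_apply]

theorem fillHom_antisym {n : ℕ} (nu : YoungDiagram) (u : Filling n) (f : WordModule n) :
    fillHom nu (u.antisym f) = u.antisym (fillHom nu f) := by
  rw [Filling.antisym_eq, Filling.antisym_eq, map_sum]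
  exact Finset.sum_congr rfl fun s _ => by rw [map_smul, fillHom_wordRep]

/-- A Young tableau as a filling. -/
def YoungTableau.filling {nu : YoungDiagram} {n : ℕ} (U : YoungTableau nu n) : Filling n :=
  fun x => some (U.symm x).1

theorem YoungTableau.isTableau_filling {nu : YoungDiagram} {n : ℕ} (U : YoungTableau nu n) :
    U.filling.IsTableau nu where
  mem_iff c := by
    constructor
    · intro h
      exact ⟨U ⟨c, h⟩, by simp [filling]⟩
    · rintro ⟨x, hx⟩
      simp only [filling, Option.some.injEq] at hx
      rw [← hx]
      exact (U.symm x).2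
  inj x y c hx hy := by
    simp only [filling, Option.some.injEq] at hx hy
    exact U.symm.injective (Subtype.ext (hx.trans hy.symm))

namespace Filling

variable {n : ℕ} {lam nu nu' : YoungDiagram} {u : Filling n}

theorem IsTableau.hasContent (h : IsTableau nu u) : HasContent nu u.rowWord := by
  intro i
  symm
  have hex : ∀ k ∈ Finset.range (nu.rowLen i), ∃ y, u y = some (i, k) := fun k hk =>
    (h.mem_iff _).1 (YoungDiagram.mem_iff_lt_rowLen.2 (Finset.mem_range.1 hk))
  choose f hf using hex
  refine (Finset.card_range _).symm.trans (Finset.card_bij f ?_ ?_ ?_)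
  · intro k hk
    simp [rowWord_of_eq_some (hf k hk)]
  · intro k hk l hl e
    have := hf k hk
    rw [e, hf l hl] at this
    simpa using this.symm
  · intro y hy
    simp only [Finset.mem_filter, Finset.mem_univ, true_and, rowWord, Option.map_eq_some_iff] at hy
    obtain ⟨⟨a, k⟩, hy, rfl⟩ := hy
    have hk := YoungDiagram.mem_iff_lt_rowLen.1 ((h.mem_iff _).2 ⟨y, hy⟩)
    exact ⟨k, Finset.mem_range.2 hk, h.inj _ _ _ (hf k _) hy⟩

theorem ne_none_of_hasContent {w : Fin n → Option ℕ} (hw : HasContent nu w) (hnu : nu.card = n)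
    (x : Fin n) : w x ≠ none := by
  obtain ⟨U⟩ := YoungTableau.nonempty_of_card hnu
  have h1 := hw.sum_eq (fun o => if o = none then 0 else 1) rfl
  rw [← U.isTableau_filling.hasContent.sum_eq (fun o => if o = none then 0 else 1) rfl] at h1
  have h2 : ∀ y, (if rowWord U.filling y = none then 0 else 1) = 1 := fun y => by
    simp [rowWord, YoungTableau.filling]
  simp only [h2] at h1
  have h3 := (Finset.sum_eq_sum_iff_of_le (s := Finset.univ)
    (f := fun y => if w y = none then 0 else 1) (g := fun _ : Fin n => 1)
    (fun y _ => by split_ifs <;> simp)).1 h1 x (Finset.mem_univ x)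
  intro hc
  simp [hc] at h3

theorem IsTableau.ne_none (h : IsTableau nu u) (hnu : nu.card = n) (x : Fin n) : u x ≠ none :=
  fun hc => ne_none_of_hasContent h.hasContent hnu x (rowWord_of_eq_none hc)

/-- Keep only the boxes that lie in `lam`. -/
def restrict (lam : YoungDiagram) (u : Filling n) : Filling n := fun x => (u x).filter (· ∈ lam)

theorem restrict_eq_some {x : Fin n} {c : ℕ × ℕ} :
    u.restrict lam x = some c ↔ u x = some c ∧ c ∈ lam := by
  simp [restrict, Option.filter_eq_some_iff]

theorem IsTableau.restrict (h : IsTableau nu u) (hle : lam ≤ nu) :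
    IsTableau lam (u.restrict lam) := by
  refine ⟨fun c => ?_, fun x y c hx hy => ?_⟩
  · simp only [restrict_eq_some]
    constructor
    · intro hc
      obtain ⟨x, hx⟩ := (h.mem_iff c).1 (hle hc)
      exact ⟨x, hx, hc⟩
    · rintro ⟨x, -, hc⟩
      exact hc
  · exact h.inj x y c (restrict_eq_some.1 hx).1 (restrict_eq_some.1 hy).1

theorem _root_.Interlaces.le (h : Interlaces lam nu) : lam ≤ nu := by
  rintro ⟨i, j⟩ hij
  exact YoungDiagram.mem_iff_lt_rowLen.2 ((YoungDiagram.mem_iff_lt_rowLen.1 hij).trans_le (h i).2)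

theorem colStab_restrict_le (u : Filling n) : (u.restrict lam).colStab ≤ u.colStab := by
  intro s hs x
  obtain ⟨h1, h2⟩ := hs x
  cases hx : u.restrict lam x with
  | none => rw [h2 hx]; simp
  | some c =>
    rw [hx, Option.map_some, Option.map_eq_some_iff] at h1
    obtain ⟨d, hd, e⟩ := h1
    simp [(restrict_eq_some.1 hd).1, (restrict_eq_some.1 hx).1, e]

theorem wordRep_mem_standardSpan (g : Perm (Fin n)) {f : WordModule n}
    (hf : f ∈ standardSpan lam n) : wordRep n g f ∈ standardSpan lam n := by
  induction hf using Submodule.span_induction with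
  | mem x hx =>
    obtain ⟨p, rfl⟩ := hx
    simp only [wordRep_polytabloid]
    exact (p.2.isTableau.comp _).polytabloid_mem
  | zero => simp
  | add x y _ _ hx hy => rw [map_add]; exact add_mem hx hy
  | smul c x _ hx => rw [map_smul]; exact Submodule.smul_mem _ _ hx

theorem antisym_mem_standardSpan (p : Filling n) {f : WordModule n} (hf : f ∈ standardSpan lam n) :
    p.antisym f ∈ standardSpan lam n := by
  rw [antisym_eq]
  exact Submodule.sum_mem _ fun s _ => Submodule.smul_mem _ _ (wordRep_mem_standardSpan _ hf)

/-- The column antisymmetrization of a tableau from which a horizontal strip is removed. -/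
def stripElement (lam : YoungDiagram) (u : Filling n) : WordModule n :=
  u.antisym (wordDelta (u.restrict lam).rowWord)

/-- Antisymmetrizing the polytabloid of the restricted tableau over all of `u.colStab` gives the
strip element once for each member of the smaller stabilizer. Purity divides out this number. -/
theorem IsTableau.stripElement_mem (h : IsTableau nu u) (hle : lam ≤ nu) :
    stripElement lam u ∈ standardSpan lam n := by
  classical
  have h1 : u.antisym (u.restrict lam).polytabloid =
      (Fintype.card (u.restrict lam).colStab : ℤ) • stripElement lam u := by
    rw [polytabloid, antisym_eq (u.restrict lam), map_sum, natCast_zsmul, ← Finset.card_univ,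
      ← Finset.sum_const]
    refine Finset.sum_congr rfl fun s _ => ?_
    rw [map_smul, antisym_wordRep (colStab_restrict_le u s.2), smul_smul, stripElement]
    rcases Int.units_eq_one_or (Perm.sign s.1) with h | h <;> simp [h]
  refine mem_standardSpan_of_smul_mem (k := Fintype.card (u.restrict lam).colStab) ?_ ?_
  · exact_mod_cast Fintype.card_ne_zero
  · rw [← h1]
    exact antisym_mem_standardSpan u (h.restrict hle).polytabloid_mem

/-- If `w` had a letter i' < i at the symbol in box (i, j), then j < ν_i ≤ ν_{i'+1} ≤ λ_{i'}. So
(i', j) is a box of λ, and its symbol carries the letter i' already, against column injectivity.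
Hence `w` is pointwise at least the row word. The sums of the letters are the two depths, so the
depth hypothesis forces equality. -/
theorem eq_rowWord_of_fillHom_ne_zero (h : IsTableau nu u) (hnu : nu.card = n)
    (hi : Interlaces lam nu) (hnu' : nu'.card = n) (hd : nu'.depth ≤ nu.depth)
    {w : Fin n → Option ℕ} (hw : u.ColInjective w)
    (h0 : fillHom nu' (wordDelta (u.restrict lam).rowWord) w ≠ 0) :
    HasContent nu' w ∧ w = u.rowWord := by
  classical
  rw [fillHom_apply] at h0
  have hc : HasContent nu' w := by
    by_contra hc
    exact h0 (if_neg hc)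
  refine ⟨hc, ?_⟩
  rw [if_pos hc] at h0
  obtain ⟨B, -, hB⟩ := Finset.exists_ne_zero_of_sum_ne_zero h0
  have hB' : eraseAt w B = (u.restrict lam).rowWord := by
    by_contra hne
    exact hB (by rw [wordDelta_apply, if_neg hne])
  have hin : ∀ x c, u x = some c → c ∈ lam → w x = some c.1 := by
    intro x c hx hc
    have := congrFun hB' x
    rw [rowWord_of_eq_some (restrict_eq_some.2 ⟨hx, hc⟩), eraseAt] at this
    by_cases hxB : x ∈ B
    · simp [hxB] at this
    · simpa [hxB] using this
  have hle : ∀ x ∈ Finset.univ, (u.rowWord x).getD 0 ≤ (w x).getD 0 := by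
    intro x _
    obtain ⟨⟨i, j⟩, hx⟩ := Option.ne_none_iff_exists'.1 (h.ne_none hnu x)
    obtain ⟨i', hi'⟩ := Option.ne_none_iff_exists'.1 (ne_none_of_hasContent hc hnu' x)
    rw [rowWord_of_eq_some hx, hi']
    simp only [Option.getD_some]
    by_contra hlt
    rw [not_le] at hlt
    have hij : j < nu.rowLen i := YoungDiagram.mem_iff_lt_rowLen.1 ((h.mem_iff _).2 ⟨x, hx⟩)
    have hlam : (i', j) ∈ lam := YoungDiagram.mem_iff_lt_rowLen.2
      (hij.trans_le ((nu.rowLen_anti _ _ hlt).trans (hi i').1))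
    obtain ⟨z, hz⟩ := (h.mem_iff _).1 (hi.le hlam)
    have hzx := hw z x _ _ hz hx rfl ((hin z _ hz hlam).trans hi'.symm)
    rw [hzx, hx] at hz
    simp only [Option.some.injEq, Prod.mk.injEq, and_true] at hz
    omega
  have hsum : ∑ x, (u.rowWord x).getD 0 = ∑ x, (w x).getD 0 := by
    refine le_antisymm (Finset.sum_le_sum hle) ?_
    rw [h.hasContent.sum_eq (fun o => o.getD 0) rfl, hc.sum_eq (fun o => o.getD 0) rfl]
    exact hd
  ext1 x
  have := (Finset.sum_eq_sum_iff_of_le hle).1 hsum x (Finset.mem_univ x)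
  obtain ⟨c, hx⟩ := Option.ne_none_iff_exists'.1 (h.ne_none hnu x)
  obtain ⟨i', hi'⟩ := Option.ne_none_iff_exists'.1 (ne_none_of_hasContent hc hnu' x)
  rw [rowWord_of_eq_some hx, hi'] at this ⊢
  simpa using this.symm

/-- The row word contains no `none`, so the erased set must be the set of symbols outside `lam`. -/
theorem fillHom_wordDelta_rowWord (h : IsTableau nu u) (hnu : nu.card = n) :
    fillHom nu (wordDelta (u.restrict lam).rowWord) u.rowWord = 1 := by
  classical
  rw [fillHom_apply, if_pos h.hasContent,
    Finset.sum_eq_single (Finset.univ.filter fun x => u.restrict lam x = none)]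
  · rw [wordDelta_apply, if_pos]
    ext1 x
    cases hx : u.restrict lam x with
    | none => simp [eraseAt, hx, rowWord_of_eq_none hx]
    | some c =>
      simp [eraseAt, hx, rowWord_of_eq_some hx, rowWord_of_eq_some (restrict_eq_some.1 hx).1]
  · intro B _ hB
    rw [wordDelta_apply, if_neg]
    intro e
    apply hB
    ext x
    have hx := congrFun e x
    obtain ⟨c, hc⟩ := Option.ne_none_iff_exists'.1 (h.ne_none hnu x)
    simp only [eraseAt, rowWord_of_eq_some hc] at hx
    cases hr : u.restrict lam x with
    | none =>
      rw [rowWord_of_eq_none hr] at hx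
      simp [hr]
      by_contra hxB
      simp [hxB] at hx
    | some d =>
      rw [rowWord_of_eq_some hr] at hx
      simp [hr]
      intro hxB
      simp [hxB] at hx
  · simp

theorem fillHom_stripElement_of_ne (h : IsTableau nu u) (hnu : nu.card = n)
    (hi : Interlaces lam nu) (hnu' : nu'.card = n) (hd : nu'.depth ≤ nu.depth) (hne : nu' ≠ nu) :
    fillHom nu' (stripElement lam u) = 0 := by
  rw [stripElement, fillHom_antisym, antisym_congr (f' := 0), map_zero]
  intro w hw
  by_contra h0
  obtain ⟨h1, rfl⟩ := eq_rowWord_of_fillHom_ne_zero h hnu hi hnu' hd hw h0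
  exact hne (eq_of_hasContent h1 h.hasContent)

theorem fillHom_stripElement (h : IsTableau nu u) (hnu : nu.card = n) (hi : Interlaces lam nu) :
    fillHom nu (stripElement lam u) = u.polytabloid := by
  rw [stripElement, fillHom_antisym, polytabloid]
  refine antisym_congr fun w hw => ?_
  by_cases hwu : w = u.rowWord
  · rw [hwu, fillHom_wordDelta_rowWord h hnu]; simp
  · rw [wordDelta_apply, if_neg hwu]
    by_contra h0
    exact hwu (eq_rowWord_of_fillHom_ne_zero h hnu hi hnu le_rfl hw h0).2

end Filling

/-! ### The filtration by kernels and its ranks. -/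

/-- A sublattice of the same rank has torsion quotient. -/
theorem exists_smul_mem_of_finrank_eq {M : Type*} [AddCommGroup M] {S K : Submodule ℤ M}
    [Module.Finite ℤ K] (h : S ≤ K) (hr : Module.finrank ℤ K = Module.finrank ℤ S) {x : M}
    (hx : x ∈ K) : ∃ a : ℤ, a ≠ 0 ∧ a • x ∈ S := by
  have h1 := Submodule.finrank_quotient_add_finrank (S.submoduleOf K)
  rw [(Submodule.submoduleOfEquivOfLe h).finrank_eq, hr, Nat.add_eq_right,
    Module.finrank_eq_zero_iff] at h1
  obtain ⟨a, ha, hax⟩ := h1 (Submodule.Quotient.mk ⟨x, hx⟩)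
  refine ⟨a, ha, ?_⟩
  rw [← Submodule.Quotient.mk_smul, Submodule.Quotient.mk_eq_zero] at hax
  exact hax

namespace Filling

variable {n : ℕ} {lam : YoungDiagram}

instance finite_standard (lam : YoungDiagram) (n : ℕ) :
    Finite {p : Filling n // IsStandard lam p} :=
  ((finite_setOf_isTableau lam n).subset fun _ h => IsStandard.isTableau h :
    {p : Filling n | IsStandard lam p}.Finite).to_subtype

instance (lam : YoungDiagram) (n : ℕ) : Module.Finite ℤ (standardSpan lam n) :=
  Module.Finite.span_of_finite ℤ (Set.finite_range _)

theorem finrank_standardSpan (lam : YoungDiagram) (n : ℕ) :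
    Module.finrank ℤ (standardSpan lam n) = (standards lam n).card := by
  classical
  have := Fintype.ofFinite {p : Filling n // IsStandard lam p}
  rw [standardSpan, finrank_span_eq_card (linearIndependent_standard lam n)]
  refine Fintype.card_of_subtype _ fun p => mem_standards

/-- The elements of the standard span killed by the first `i` filling homomorphisms. -/
def stratum (lam : YoungDiagram) (n : ℕ) (d : ℕ → YoungDiagram) (i : ℕ) :
    Submodule ℤ (WordModule n) :=
  standardSpan lam n ⊓ ⨅ j : {j : ℕ // j < i}, LinearMap.ker (fillHom (d j))

variable {d : ℕ → YoungDiagram}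

theorem mem_stratum {i : ℕ} {f : WordModule n} :
    f ∈ stratum lam n d i ↔ f ∈ standardSpan lam n ∧ ∀ j < i, fillHom (d j) f = 0 := by
  simp [stratum, Submodule.mem_iInf]

theorem mem_stratum_succ {i : ℕ} {f : WordModule n} :
    f ∈ stratum lam n d (i + 1) ↔ f ∈ stratum lam n d i ∧ fillHom (d i) f = 0 := by
  simp only [mem_stratum, Nat.lt_succ_iff_lt_or_eq, or_imp, forall_and, forall_eq, and_assoc]

theorem stratum_le (i : ℕ) : stratum lam n d i ≤ standardSpan lam n := inf_le_left

instance (i : ℕ) : Module.Finite ℤ (stratum lam n d i) :=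
  Module.Finite.of_injective (Submodule.inclusion (stratum_le i)) (Submodule.inclusion_injective _)

theorem wordRep_mem_stratum {i : ℕ} (g : Perm (Fin n)) {f : WordModule n}
    (hf : f ∈ stratum lam n d i) : wordRep n g f ∈ stratum lam n d i := by
  rw [mem_stratum] at hf ⊢
  exact ⟨wordRep_mem_standardSpan g hf.1, fun j hj => by rw [fillHom_wordRep, hf.2 j hj, map_zero]⟩

/-- Purity of the strata is what makes the filtration compatible with reduction modulo m. -/
theorem mem_stratum_of_smul_mem {i : ℕ} {k : ℤ} (hk : k ≠ 0) {f : WordModule n}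
    (hf : k • f ∈ stratum lam n d i) : f ∈ stratum lam n d i := by
  rw [mem_stratum] at hf ⊢
  refine ⟨mem_standardSpan_of_smul_mem hk hf.1, fun j hj => ?_⟩
  have := hf.2 j hj
  rw [map_smul] at this
  exact (smul_eq_zero.1 this).resolve_left hk

theorem finrank_stratum (i : ℕ) :
    Module.finrank ℤ (stratum lam n d i) =
      Module.finrank ℤ ((stratum lam n d i).map (fillHom (d i))) +
        Module.finrank ℤ (stratum lam n d (i + 1)) := by
  rw [← Submodule.finrank_quotient_add_finrank
      (LinearMap.ker ((fillHom (d i)).domRestrict (stratum lam n d i))),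
    (LinearMap.quotKerEquivRange _).finrank_eq, LinearMap.range_domRestrict]
  congr 1
  have hle : stratum lam n d (i + 1) ≤ stratum lam n d i := fun f hf => (mem_stratum_succ.1 hf).1
  have : LinearMap.ker ((fillHom (d i)).domRestrict (stratum lam n d i)) =
      (stratum lam n d (i + 1)).submoduleOf (stratum lam n d i) := by
    ext f
    rw [LinearMap.mem_ker, Submodule.submoduleOf, Submodule.mem_comap, mem_stratum_succ]
    exact ⟨fun h => ⟨f.2, h⟩, fun h => h.2⟩
  rw [this]
  exact (Submodule.submoduleOfEquivOfLe hle).finrank_eq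

/-- `d` lists diagrams that arise from `lam` by adding horizontal strips, shallow ones first. -/
structure IsStripList (lam : YoungDiagram) (n k : ℕ) (d : ℕ → YoungDiagram) : Prop where
  card_eq : ∀ i < k, (d i).card = n
  interlaces : ∀ i < k, Interlaces lam (d i)
  depth_le : ∀ i j, i < j → j < k → (d i).depth ≤ (d j).depth
  ne : ∀ i j, i < j → j < k → d i ≠ d j
  sum_card : ∑ i ∈ Finset.range k, (standards (d i) n).card = (standards lam n).card

variable {k : ℕ}

/-- Strip elements lift the standard polytabloids; the earlier diagrams of the list have no greater
depth, so their filling maps kill these lifts. -/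
theorem IsStripList.le_map (h : IsStripList lam n k d) {i : ℕ} (hi : i < k) :
    standardSpan (d i) n ≤ (stratum lam n d i).map (fillHom (d i)) := by
  rw [standardSpan, Submodule.span_le]
  rintro _ ⟨⟨u, hu⟩, rfl⟩
  refine ⟨stripElement lam u, mem_stratum.2
    ⟨hu.isTableau.stripElement_mem (h.interlaces i hi).le, fun j hj => ?_⟩,
    fillHom_stripElement hu.isTableau (h.card_eq i hi) (h.interlaces i hi)⟩
  exact fillHom_stripElement_of_ne hu.isTableau (h.card_eq i hi) (h.interlaces i hi)
    (h.card_eq j (hj.trans hi)) (h.depth_le j i hj hi) (h.ne j i hj hi)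

/-- By rank-nullity the ranks of the images and of the last stratum add up to the rank of
`standardSpan lam n`. The lower bounds from `le_map` already have this total, so each is attained
and nothing remains. -/
theorem IsStripList.finrank_aux (h : IsStripList lam n k d) :
    (∀ i < k, Module.finrank ℤ ((stratum lam n d i).map (fillHom (d i))) =
      Module.finrank ℤ (standardSpan (d i) n)) ∧
    Module.finrank ℤ (stratum lam n d k) = 0 := by
  have h0 : ∀ m, Module.finrank ℤ (stratum lam n d 0) =
      ∑ i ∈ Finset.range m, Module.finrank ℤ ((stratum lam n d i).map (fillHom (d i))) +
        Module.finrank ℤ (stratum lam n d m) := by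
    intro m
    induction m with
    | zero => simp
    | succ m ih => rw [ih, Finset.sum_range_succ, add_assoc, finrank_stratum m]
  have h1 : stratum lam n d 0 = standardSpan lam n := by
    ext f; simp [mem_stratum]
  have h2 := h0 k
  rw [h1, finrank_standardSpan, ← h.sum_card] at h2
  have hle : ∀ i ∈ Finset.range k, (standards (d i) n).card ≤
      Module.finrank ℤ ((stratum lam n d i).map (fillHom (d i))) := fun i hi => by
    rw [← finrank_standardSpan]
    exact Submodule.finrank_mono (h.le_map (Finset.mem_range.1 hi))
  have h3 := Finset.sum_le_sum hle
  refine ⟨fun i hi => ?_, by omega⟩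
  rw [finrank_standardSpan]
  exact ((Finset.sum_eq_sum_iff_of_le hle).1 (by omega) i (Finset.mem_range.2 hi)).symm

/-- Equal rank makes the quotient torsion; purity of the Specht lattice makes it trivial. -/
theorem IsStripList.map_eq (h : IsStripList lam n k d) {i : ℕ} (hi : i < k) :
    (stratum lam n d i).map (fillHom (d i)) = standardSpan (d i) n := by
  refine le_antisymm (fun x hx => ?_) (h.le_map hi)
  obtain ⟨a, ha, hax⟩ := exists_smul_mem_of_finrank_eq (h.le_map hi) (h.finrank_aux.1 i hi) hx
  exact mem_standardSpan_of_smul_mem ha hax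

theorem IsStripList.stratum_eq_bot (h : IsStripList lam n k d) : stratum lam n d k = ⊥ :=
  Submodule.finrank_eq_zero.1 h.finrank_aux.2

end Filling

/-! ### Group ring modules; the Specht left ideal as a lattice of functions. -/

/-- Two epimorphisms with the same kernel have isomorphic targets. -/
theorem exists_linearEquiv_of_eq_zero_iff {R M A B : Type*} [Ring R] [AddCommGroup M]
    [AddCommGroup A] [AddCommGroup B] [Module R M] [Module R A] [Module R B] (f : M →ₗ[R] A)
    (g : M →ₗ[R] B) (hf : Function.Surjective f) (hg : Function.Surjective g)
    (h : ∀ x, f x = 0 ↔ g x = 0) : ∃ e : A ≃ₗ[R] B, ∀ x, e (f x) = g x := by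
  have hk : LinearMap.ker f = LinearMap.ker g := by ext x; exact h x
  refine ⟨(f.quotKerEquivOfSurjective hf).symm.trans ((Submodule.quotEquivOfEq _ _ hk).trans
    (g.quotKerEquivOfSurjective hg)), fun x => ?_⟩
  rw [LinearEquiv.trans_apply, LinearEquiv.trans_apply, LinearMap.quotKerEquivOfSurjective_symm_apply]
  rfl

namespace WordModule

variable {n : ℕ}

instance instModuleIntSym (n : ℕ) : Module (IntSym n) (WordModule n) :=
  Module.compHom _ (wordRep n).asAlgebraHom.toRingHom

theorem single_smul (g : Perm (Fin n)) (r : ℤ) (f : WordModule n) :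
    (MonoidAlgebra.single g r : IntSym n) • f = r • wordRep n g f := by
  change (wordRep n).asAlgebraHom (MonoidAlgebra.single g r) f = _
  rw [Representation.asAlgebraHom_single]; rfl

/-- A sublattice of functions of words that is stable under permutations. -/
def toSubmodule (S : Submodule ℤ (WordModule n)) (h : ∀ g, ∀ f ∈ S, wordRep n g f ∈ S) :
    Submodule (IntSym n) (WordModule n) where
  carrier := S
  zero_mem' := S.zero_mem
  add_mem' := S.add_mem
  smul_mem' x f hf := by
    induction x using MonoidAlgebra.induction_linear with
    | zero => rw [zero_smul]; exact S.zero_mem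
    | add x y hx hy => rw [add_smul]; exact S.add_mem hx hy
    | single g r => rw [single_smul]; exact S.smul_mem _ (h g f hf)

/-- The filling homomorphism is `ℤ Sₙ`-linear. -/
def fillMap (nu : YoungDiagram) : WordModule n →ₗ[IntSym n] WordModule n where
  toFun := fillHom nu
  map_add' := map_add _
  map_smul' x f := by
    rw [RingHom.id_apply]
    induction x using MonoidAlgebra.induction_linear with
    | zero => rw [zero_smul, zero_smul, map_zero]
    | add x y hx hy => rw [add_smul, add_smul, map_add, hx, hy]
    | single g r => rw [single_smul, single_smul, map_smul, fillHom_wordRep]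

end WordModule

namespace Filling

open WordModule

variable {n : ℕ} {lam nu : YoungDiagram} {p q : Filling n}

/-- The Specht module in the module of functions of words. -/
def spechtWord (lam : YoungDiagram) (n : ℕ) : Submodule (IntSym n) (WordModule n) :=
  toSubmodule (standardSpan lam n) fun g _ hf => wordRep_mem_standardSpan g hf

theorem mem_spechtWord {f : WordModule n} : f ∈ spechtWord lam n ↔ f ∈ standardSpan lam n := Iff.rfl

theorem IsTableau.existsUnique_box (h : IsTableau lam p) :
    Function.Bijective fun x : {x // (p x).isSome} =>
      (⟨(p x.1).get x.2, (h.mem_iff _).2 ⟨x.1, by simp⟩⟩ : {c // c ∈ lam}) := by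
  constructor
  · rintro ⟨x, hx⟩ ⟨y, hy⟩ e
    simp only [Subtype.mk.injEq] at e
    exact Subtype.ext (h.inj x y _ (Option.some_get hx).symm (by rw [e]; simp))
  · rintro ⟨c, hc⟩
    obtain ⟨x, hx⟩ := (h.mem_iff c).1 hc
    exact ⟨⟨x, by simp [hx]⟩, by simp [hx]⟩

theorem IsTableau.exists_perm (hp : IsTableau lam p) (hq : IsTableau lam q) :
    ∃ g : Perm (Fin n), q = p ∘ g := by
  let ep := Equiv.ofBijective _ hp.existsUnique_box
  let eq := Equiv.ofBijective _ hq.existsUnique_box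
  let e : {x // (q x).isSome} ≃ {x // (p x).isSome} := eq.trans ep.symm
  refine ⟨e.extendSubtype, funext fun x => ?_⟩
  by_cases hx : (q x).isSome
  · rw [Function.comp, e.extendSubtype_apply_of_mem x hx]
    have h1 : ep (e ⟨x, hx⟩) = eq ⟨x, hx⟩ := by simp [e]
    have h2 := congrArg Subtype.val h1
    simp only [ep, eq, Equiv.ofBijective_apply] at h2
    exact Option.get_inj.1 h2.symm
  · have h2 := e.extendSubtype_not_mem x hx
    rw [Option.not_isSome_iff_eq_none] at hx
    rw [Option.not_isSome_iff_eq_none] at h2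
    rw [hx, Function.comp, h2]

/-- Any two fillings of `lam` differ by a permutation, so standard polytabloids are translates of
`p.polytabloid`; the other inclusion is straightening. -/
theorem IsTableau.spechtWord_eq_span (hp : IsTableau lam p) :
    spechtWord lam n = Submodule.span (IntSym n) {p.polytabloid} := by
  apply le_antisymm
  · intro f hf
    rw [mem_spechtWord, standardSpan] at hf
    induction hf using Submodule.span_induction with
    | mem x hx =>
      obtain ⟨⟨q, hq⟩, rfl⟩ := hx
      obtain ⟨g, rfl⟩ := hp.exists_perm hq.isTableau
      have h1 := wordRep_polytabloid g⁻¹ p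
      rw [inv_inv] at h1
      have h2 := single_smul g⁻¹ 1 p.polytabloid
      rw [one_smul, h1] at h2
      change polytabloid (p ∘ g) ∈ _
      rw [← h2]
      exact Submodule.smul_mem _ _ (Submodule.mem_span_singleton_self _)
    | zero => exact Submodule.zero_mem _
    | add x y _ _ hx hy => exact add_mem hx hy
    | smul c x _ hx =>
      have : c • x = (MonoidAlgebra.single 1 c : IntSym n) • x := by
        rw [single_smul, map_one]; rfl
      rw [this]
      exact Submodule.smul_mem _ _ hx
  · rw [Submodule.span_singleton_le_iff_mem]
    exact hp.polytabloid_mem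

theorem IsTableau.mem_spechtWord_iff (hp : IsTableau lam p) {f : WordModule n} :
    f ∈ spechtWord lam n ↔ ∃ x : IntSym n, x • p.polytabloid = f := by
  rw [hp.spechtWord_eq_span, Submodule.mem_span_singleton]

end Filling

namespace YoungTableau

open WordModule Filling

variable {n : ℕ} {lam : YoungDiagram} (U : YoungTableau lam n)

theorem mem_colStab_filling {s : Perm (Fin n)} : s ∈ U.filling.colStab ↔ s ∈ U.colStab := by
  rw [colStab, Finset.mem_filter]
  simp [Filling.mem_colStab, filling, colOf]

theorem mem_rowStab {s : Perm (Fin n)} :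
    s ∈ U.rowStab ↔ U.filling.rowWord ∘ s = U.filling.rowWord := by
  rw [rowStab, Finset.mem_filter]
  simp [filling, rowOf, rowWord, funext_iff]

theorem inv_mem_rowStab {s : Perm (Fin n)} (hs : s ∈ U.rowStab) : s⁻¹ ∈ U.rowStab := by
  rw [mem_rowStab] at hs ⊢
  conv_lhs => rw [← hs]
  ext1 x
  simp

theorem colAntisymmetrizer_smul (f : WordModule n) :
    U.colAntisymmetrizer • f = U.filling.antisym f := by
  classical
  rw [colAntisymmetrizer, Finset.sum_smul, antisym_eq]
  refine (Finset.sum_subtype _ (fun s => (U.mem_colStab_filling (s := s)).symm) _).trans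
    (Finset.sum_congr rfl fun s _ => ?_)
  rw [single_smul]

theorem rowSymmetrizer_smul : U.rowSymmetrizer • wordDelta U.filling.rowWord =
    (U.rowStab.card : ℤ) • wordDelta U.filling.rowWord := by
  rw [rowSymmetrizer, Finset.sum_smul, natCast_zsmul, ← Finset.sum_const]
  refine Finset.sum_congr rfl fun s hs => ?_
  rw [single_smul, one_smul, wordRep_wordDelta]
  congr 1
  rw [mem_rowStab] at hs
  conv_lhs => rw [← hs]
  ext1 x
  simp

/-- Read off the coefficient of `g` at the row word of `g U`. -/
def readOff : WordModule n →ₗ[ℤ] IntSym n :=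
  ∑ g : Perm (Fin n), (LinearMap.proj (U.filling.rowWord ∘ ⇑g⁻¹) : WordModule n →ₗ[ℤ] ℤ).smulRight
    (MonoidAlgebra.single g (1 : ℤ) : IntSym n)

theorem readOff_apply (f : WordModule n) : U.readOff f =
    ∑ g : Perm (Fin n), f (U.filling.rowWord ∘ ⇑g⁻¹) • (MonoidAlgebra.single g 1 : IntSym n) := by
  simp only [readOff, LinearMap.sum_apply, LinearMap.smulRight_apply, LinearMap.proj_apply]

/-- The words `rowWord ∘ g⁻¹` correspond to the left cosets of the row stabilizer, and `readOff`
turns the indicator of such a word into the sum over its coset. -/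
theorem readOff_smul_wordDelta (y : IntSym n) :
    U.readOff (y • wordDelta U.filling.rowWord) = y * U.rowSymmetrizer := by
  induction y using MonoidAlgebra.induction_linear with
  | zero => rw [zero_smul, map_zero, zero_mul]
  | add x y hx hy => rw [add_smul, map_add, add_mul, hx, hy]
  | single h r =>
    rw [single_smul, map_smul, readOff_apply, rowSymmetrizer, Finset.mul_sum, Finset.smul_sum]
    have e : ∀ g : Perm (Fin n), r • (wordRep n h (wordDelta U.filling.rowWord)
        (U.filling.rowWord ∘ ⇑g⁻¹) • (MonoidAlgebra.single g 1 : IntSym n)) =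
        if g⁻¹ * h ∈ U.rowStab then MonoidAlgebra.single g r else 0 := by
      intro g
      rw [wordRep_apply, wordDelta_apply, Function.comp_assoc, ← Perm.coe_mul]
      simp only [mem_rowStab]
      split_ifs with h1
      · simp
      · simp
    rw [Finset.sum_congr rfl fun g _ => e g, ← Finset.sum_filter]
    refine Finset.sum_bij' (fun g _ => h⁻¹ * g) (fun s _ => h * s) ?_ ?_ ?_ ?_ ?_
    · intro g hg
      have := U.inv_mem_rowStab (Finset.mem_filter.1 hg).2
      rwa [mul_inv_rev, inv_inv] at this
    · intro s hs
      rw [Finset.mem_filter, mul_inv_rev, inv_mul_cancel_right]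
      exact ⟨Finset.mem_univ _, U.inv_mem_rowStab hs⟩
    · intro g _; simp
    · intro s _; simp
    · intro g _; simp [MonoidAlgebra.single_mul_single]

/-- One direction is `readOff`. For the other, the row symmetrizer multiplies the indicator by the
order of the row stabilizer, which can be cancelled. -/
theorem smul_wordDelta_eq_zero_iff (y : IntSym n) :
    y • wordDelta U.filling.rowWord = 0 ↔ y * U.rowSymmetrizer = 0 := by
  constructor
  · intro h
    rw [← readOff_smul_wordDelta, h, map_zero]
  · intro h
    have h1 : (U.rowStab.card : ℤ) • (y • wordDelta U.filling.rowWord) = 0 := by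
      rw [smul_comm, ← rowSymmetrizer_smul, ← mul_smul, h, zero_smul]
    refine (smul_eq_zero.1 h1).resolve_left ?_
    have : (1 : Perm (Fin n)) ∈ U.rowStab := by simp [mem_rowStab]
    exact_mod_cast (Finset.card_pos.2 ⟨1, this⟩).ne'

theorem smul_polytabloid_eq_zero_iff (x : IntSym n) :
    x • U.filling.polytabloid = 0 ↔ x * (U.colAntisymmetrizer * U.rowSymmetrizer) = 0 := by
  rw [polytabloid, ← colAntisymmetrizer_smul, ← mul_smul, smul_wordDelta_eq_zero_iff, mul_assoc]

/-- The generator of the Specht module. -/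
def spechtGen : U.specht :=
  ⟨U.colAntisymmetrizer * U.rowSymmetrizer, Submodule.mem_span_singleton_self _⟩

theorem exists_smul_spechtGen (v : U.specht) : ∃ x : IntSym n, x • U.spechtGen = v := by
  obtain ⟨x, hx⟩ := Submodule.mem_span_singleton.1 v.2
  exact ⟨x, Subtype.ext hx⟩

theorem smul_spechtGen_eq_zero_iff (x : IntSym n) :
    x • U.spechtGen = 0 ↔ x • U.filling.polytabloid = 0 := by
  rw [smul_polytabloid_eq_zero_iff, ← Submodule.coe_eq_zero]
  rfl

/-- The Specht module as a left ideal is isomorphic to the one in the functions of words. -/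
theorem exists_spechtEquiv : ∃ e : U.specht ≃ₗ[IntSym n] spechtWord lam n,
    ∀ x : IntSym n, (e (x • U.spechtGen) : WordModule n) = x • U.filling.polytabloid := by
  obtain ⟨e, he⟩ := exists_linearEquiv_of_eq_zero_iff
    (LinearMap.toSpanSingleton (IntSym n) U.specht U.spechtGen)
    (LinearMap.toSpanSingleton (IntSym n) (spechtWord lam n)
      ⟨U.filling.polytabloid, U.isTableau_filling.polytabloid_mem⟩) U.exists_smul_spechtGen
    (fun f => (U.isTableau_filling.mem_spechtWord_iff.1 f.2).imp fun x hx => Subtype.ext hx)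
    fun x => by
      rw [LinearMap.toSpanSingleton_apply, LinearMap.toSpanSingleton_apply,
        smul_spechtGen_eq_zero_iff, ← Submodule.coe_eq_zero (p := spechtWord lam n)]
      rfl
  exact ⟨e, fun x => congrArg Subtype.val (he x)⟩

end YoungTableau

/-! ### Extension from t to n symbols by the letter `none`. -/

section Extension

variable {t n : ℕ} (h : t < n)

/-- The first `t` and the last `n - t` symbols. -/
def youngEquiv : Fin t ⊕ Fin (n - t) ≃ Fin n :=
  finSumFinEquiv.trans (finCongr (Nat.add_sub_of_le h.le))

theorem youngEmbedding_inl (a : Perm (Fin t) × Perm (Fin (n - t))) (i : Fin t) :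
    youngEmbedding h a (youngEquiv h (Sum.inl i)) = youngEquiv h (Sum.inl (a.1 i)) := by
  change (youngEquiv h).permCongr (Perm.sumCongr a.1 a.2) _ = _
  simp

theorem youngEmbedding_inr (a : Perm (Fin t) × Perm (Fin (n - t))) (j : Fin (n - t)) :
    youngEmbedding h a (youngEquiv h (Sum.inr j)) = youngEquiv h (Sum.inr (a.2 j)) := by
  change (youngEquiv h).permCongr (Perm.sumCongr a.1 a.2) _ = _
  simp

theorem youngEmbedding_injective : Function.Injective (youngEmbedding h) := by
  intro a b hab
  refine Prod.ext (Perm.ext fun i => ?_) (Perm.ext fun j => ?_)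
  · have := congrArg (fun s : Perm (Fin n) => s (youngEquiv h (Sum.inl i))) hab
    simpa [youngEmbedding_inl] using this
  · have := congrArg (fun s : Perm (Fin n) => s (youngEquiv h (Sum.inr j))) hab
    simpa [youngEmbedding_inr] using this

theorem sign_youngEmbedding (a : Perm (Fin t) × Perm (Fin (n - t))) :
    Perm.sign (youngEmbedding h a) = Perm.sign a.1 * Perm.sign a.2 := by
  change Perm.sign ((youngEquiv h).permCongr (Perm.sumCongr a.1 a.2)) = _
  rw [Perm.sign_permCongr, Perm.sign_sumCongr]

theorem exists_youngEmbedding_eq {s : Perm (Fin n)}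
    (hs : ∀ i, ∃ i', s (youngEquiv h (Sum.inl i)) = youngEquiv h (Sum.inl i')) :
    ∃ a, youngEmbedding h a = s := by
  obtain ⟨a, ha⟩ := Perm.mem_sumCongrHom_range_of_perm_mapsTo_inl
    (σ := (youngEquiv h).symm.permCongr s) (by
      rintro _ ⟨i, rfl⟩
      obtain ⟨i', hi'⟩ := hs i
      exact ⟨i', by simp [Equiv.permCongr_apply, hi']⟩)
  refine ⟨a, ?_⟩
  change (youngEquiv h).permCongr (Perm.sumCongrHom _ _ a) = s
  rw [ha]
  ext x
  simp [Equiv.permCongr_apply]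

/-- Extend a partial function on the first `t` symbols. -/
def extendNone {α : Type*} (f : Fin t → Option α) : Fin n → Option α :=
  fun x => Sum.elim f (fun _ => none) ((youngEquiv h).symm x)

@[simp] theorem extendNone_inl {α : Type*} (f : Fin t → Option α) (i : Fin t) :
    extendNone h f (youngEquiv h (Sum.inl i)) = f i := by simp [extendNone]

@[simp] theorem extendNone_inr {α : Type*} (f : Fin t → Option α) (j : Fin (n - t)) :
    extendNone h f (youngEquiv h (Sum.inr j)) = none := by simp [extendNone]

theorem youngEquiv_forall {P : Fin n → Prop} : (∀ x, P x) ↔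
    (∀ i, P (youngEquiv h (Sum.inl i))) ∧ ∀ j, P (youngEquiv h (Sum.inr j)) := by
  rw [← (youngEquiv h).forall_congr_right, Sum.forall]

theorem Filling.IsTableau.extendNone {lam : YoungDiagram} {p : Filling t}
    (hp : Filling.IsTableau lam p) : Filling.IsTableau lam (extendNone h p) := by
  refine ⟨fun c => ?_, ?_⟩
  · rw [hp.mem_iff, ← not_iff_not]
    push Not
    rw [youngEquiv_forall h]
    simp
  · rw [youngEquiv_forall h]
    refine ⟨fun i => ?_, fun j => by simp⟩
    rw [youngEquiv_forall h]
    refine ⟨fun i' c hi hi' => ?_, fun j => by simp⟩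
    rw [extendNone_inl] at hi hi'
    rw [hp.inj i i' c hi hi']

open scoped Classical in
/-- Extend functions of words by zero. -/
def extendFun : WordModule t →ₗ[ℤ] WordModule n where
  toFun f w := if ∀ j, w (youngEquiv h (Sum.inr j)) = none then
    f fun i => w (youngEquiv h (Sum.inl i)) else 0
  map_add' f g := by
    ext w
    simp only [Pi.add_apply]
    split_ifs <;> simp
  map_smul' c f := by
    ext w
    simp only [Pi.smul_apply]
    split_ifs <;> simp

open scoped Classical in
theorem extendFun_apply (f : WordModule t) (w : Fin n → Option ℕ) :
    extendFun h f w = if ∀ j, w (youngEquiv h (Sum.inr j)) = none then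
      f fun i => w (youngEquiv h (Sum.inl i)) else 0 := rfl

theorem extendFun_extendNone (f : WordModule t) (w : Fin t → Option ℕ) :
    extendFun h f (extendNone h w) = f w := by
  simp [extendFun_apply]

theorem extendFun_wordRep (f : WordModule t) (a : Perm (Fin t) × Perm (Fin (n - t))) :
    extendFun h (wordRep t a.1 f) = wordRep n (youngEmbedding h a) (extendFun h f) := by
  ext w
  rw [wordRep_apply, extendFun_apply, extendFun_apply]
  have : (∀ j, (w ∘ youngEmbedding h a) (youngEquiv h (Sum.inr j)) = none) ↔
      ∀ j, w (youngEquiv h (Sum.inr j)) = none := by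
    simp only [Function.comp, youngEmbedding_inr]
    exact a.2.forall_congr_right (q := fun j => w (youngEquiv h (Sum.inr j)) = none)
  by_cases h0 : ∀ j, w (youngEquiv h (Sum.inr j)) = none
  · rw [if_pos h0, if_pos (this.2 h0), wordRep_apply]
    congr 1
    ext1 i
    simp [youngEmbedding_inl]
  · rw [if_neg h0, if_neg (fun h' => h0 (this.1 h'))]

theorem extendFun_wordDelta (w : Fin t → Option ℕ) :
    extendFun h (wordDelta w) = wordDelta (extendNone h w) := by
  ext v
  rw [extendFun_apply, wordDelta_apply, wordDelta_apply]
  have : v = extendNone h w ↔ (∀ j, v (youngEquiv h (Sum.inr j)) = none) ∧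
      (fun i => v (youngEquiv h (Sum.inl i))) = w := by
    rw [funext_iff, youngEquiv_forall h]
    simp [funext_iff, and_comm]
  rw [← ite_and]
  exact if_congr this.symm rfl rfl

theorem rowWord_extendNone (p : Filling t) :
    Filling.rowWord (extendNone h p) = extendNone h p.rowWord := by
  rw [funext_iff, youngEquiv_forall h]
  simp [Filling.rowWord]

/-- The requirement in `Filling.colStab` that unused symbols be fixed keeps the column group inside
the first factor, so extension preserves polytabloids. -/
theorem mem_colStab_extendNone {p : Filling t} {s : Perm (Fin n)} :
    s ∈ Filling.colStab (extendNone h p) ↔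
      ∃ a ∈ p.colStab, youngEmbedding h (a, 1) = s := by
  constructor
  · intro hs
    have hinr : ∀ j, s (youngEquiv h (Sum.inr j)) = youngEquiv h (Sum.inr j) := fun j =>
      (hs _).2 (by simp)
    obtain ⟨a, rfl⟩ := exists_youngEmbedding_eq h (s := s) (fun i => by
      obtain ⟨x, hx⟩ := (youngEquiv h).surjective (s (youngEquiv h (Sum.inl i)))
      rcases x with i' | j
      · exact ⟨i', hx.symm⟩
      · rw [← hinr j] at hx
        simpa using s.injective hx)
    have ha2 : a.2 = 1 := Perm.ext fun j => by
      have := hinr j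
      rw [youngEmbedding_inr] at this
      simpa using this
    refine ⟨a.1, fun i => ?_, by rw [← ha2]⟩
    have := hs (youngEquiv h (Sum.inl i))
    rw [youngEmbedding_inl] at this
    simpa using this
  · rintro ⟨a, ha, rfl⟩
    rw [Filling.mem_colStab, youngEquiv_forall h]
    refine ⟨fun i => ?_, fun j => by simp [youngEmbedding_inr]⟩
    rw [youngEmbedding_inl]
    simpa using ha i

theorem extendFun_polytabloid (p : Filling t) :
    extendFun h p.polytabloid = Filling.polytabloid (extendNone h p) := by
  classical
  rw [Filling.polytabloid, Filling.polytabloid, Filling.antisym_eq, Filling.antisym_eq, map_sum,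
    rowWord_extendNone, ← extendFun_wordDelta]
  refine Fintype.sum_bijective
    (fun s : p.colStab => (⟨youngEmbedding h (s.1, 1), (mem_colStab_extendNone h).2 ⟨_, s.2, rfl⟩⟩ :
      Filling.colStab (extendNone h p))) ⟨?_, ?_⟩ _ _ fun s => ?_
  · intro a b hab
    have := youngEmbedding_injective h (congrArg Subtype.val hab)
    exact Subtype.ext (Prod.ext_iff.1 this).1
  · rintro ⟨s, hs⟩
    obtain ⟨a, ha, rfl⟩ := (mem_colStab_extendNone h).1 hs
    exact ⟨⟨a, ha⟩, rfl⟩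
  · rw [map_smul, sign_youngEmbedding, ← extendFun_wordRep]
    simp

theorem extendFun_mem_standardSpan {lam : YoungDiagram} {f : WordModule t}
    (hf : f ∈ Filling.standardSpan lam t) : extendFun h f ∈ Filling.standardSpan lam n := by
  induction hf using Submodule.span_induction with
  | mem x hx =>
    obtain ⟨p, rfl⟩ := hx
    simp only [extendFun_polytabloid]
    exact (p.2.isTableau.extendNone h).polytabloid_mem
  | zero => simp
  | add x y _ _ hx hy => rw [map_add]; exact add_mem hx hy
  | smul c x _ hx => rw [map_smul]; exact Submodule.smul_mem _ _ hx

end Extension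

/-! ### The induced module and the annihilator of its generator. -/

section Induced

open WordModule Filling

variable {t n m : ℕ} (h : t < n) {lam : YoungDiagram} (T : YoungTableau lam t)

/-- The elements `1 ⊗ (v ⊗ 1)` of the induced module. -/
def inducedMk (M : Type) [AddCommGroup M] [Module (IntSym t) M] (g : Perm (Fin n)) :
    M →ₗ[ℤ] InducedUp h M :=
  (Representation.ind (youngEmbedding h) (outerTrivial t n M)).asModuleEquiv.symm.toLinearMap ∘ₗ
    Representation.IndV.mk (youngEmbedding h) (outerTrivial t n M) g ∘ₗ
      (TensorProduct.mk ℤ M ℤ).flip 1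

variable {M : Type} [AddCommGroup M] [Module (IntSym t) M]

/-- The induced representation is built from coinvariants, with `Sₙ` acting by right translation:
`inducedMk h M g v` stands for g⁻¹ ⊗ (v ⊗ 1). -/
theorem single_smul_inducedMk (g g' : Perm (Fin n)) (r : ℤ) (v : M) :
    (MonoidAlgebra.single g r : IntSym n) • inducedMk h M g' v = r • inducedMk h M (g' * g⁻¹) v := by
  rw [Representation.single_smul]
  congr 1
  exact Representation.ind_mk _ _ _ _ _

theorem outerTrivial_tmul (a : Perm (Fin t) × Perm (Fin (n - t))) (v : M) (z : ℤ) :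
    outerTrivial t n M a (v ⊗ₜ z) = ((MonoidAlgebra.single a.1 1 : IntSym t) • v) ⊗ₜ z := rfl

theorem inducedMk_youngEmbedding (a : Perm (Fin t) × Perm (Fin (n - t))) (g : Perm (Fin n)) (v : M) :
    inducedMk h M (youngEmbedding h a * g) ((MonoidAlgebra.single a.1 1 : IntSym t) • v) =
      inducedMk h M g v := by
  have := Representation.Coinvariants.mk_self_apply
    (Representation.tprod ((Representation.leftRegular ℤ (Perm (Fin n))).comp (youngEmbedding h))
      (outerTrivial t n M)) a (MonoidAlgebra.single g 1 ⊗ₜ (v ⊗ₜ 1))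
  rw [Representation.tprod_apply, TensorProduct.map_tmul, outerTrivial_tmul] at this
  simp at this
  exact this

theorem inducedMk_induction {P : InducedUp h M → Prop} (hadd : ∀ x y, P x → P y → P (x + y))
    (hzero : P 0) (hsmul : ∀ (r : ℤ) x, P x → P (r • x)) (hmk : ∀ g v, P (inducedMk h M g v))
    (x : InducedUp h M) : P x := by
  obtain ⟨y, rfl⟩ := Representation.Coinvariants.mk_surjective _ x
  induction y using TensorProduct.induction_on with
  | zero => rw [map_zero]; exact hzero
  | add x y hx hy => rw [map_add]; exact hadd _ _ hx hy
  | tmul y w =>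
    induction y using MonoidAlgebra.induction_linear with
    | zero => rw [TensorProduct.zero_tmul, map_zero]; exact hzero
    | add x y hx hy => rw [TensorProduct.add_tmul, map_add]; exact hadd _ _ hx hy
    | single g r =>
      induction w using TensorProduct.induction_on with
      | zero => rw [TensorProduct.tmul_zero, map_zero]; exact hzero
      | add x y hx hy => rw [TensorProduct.tmul_add, map_add]; exact hadd _ _ hx hy
      | tmul v z =>
        have e : (MonoidAlgebra.single g r : IntSym n) ⊗ₜ[ℤ] (v ⊗ₜ[ℤ] z) =
            (r * z) • ((MonoidAlgebra.single g 1 : IntSym n) ⊗ₜ[ℤ] (v ⊗ₜ[ℤ] (1 : ℤ))) := by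
          have e1 : (MonoidAlgebra.single g r : IntSym n) = r • MonoidAlgebra.single g 1 := by
            simp
          have e2 : v ⊗ₜ[ℤ] z = z • (v ⊗ₜ[ℤ] (1 : ℤ)) := by
            rw [← TensorProduct.tmul_smul]; simp
          rw [e1, e2, TensorProduct.smul_tmul_smul]
        rw [e, map_smul]
        exact hsmul _ _ (hmk g v)

end Induced

open WordModule Filling

section Induced

variable {t n m : ℕ} (h : t < n) {lam : YoungDiagram} (T : YoungTableau lam t)

theorem exists_youngEmbedding_eq_of_inr {s : Perm (Fin n)}
    (hs : ∀ j, ∃ j', s (youngEquiv h (Sum.inr j)) = youngEquiv h (Sum.inr j')) :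
    ∃ a, youngEmbedding h a = s := by
  choose f hf using hs
  have hinj : Function.Injective f := fun j j' e => by
    have := (hf j).trans ((congrArg (fun k => youngEquiv h (Sum.inr k)) e).trans (hf j').symm)
    simpa using s.injective this
  refine exists_youngEmbedding_eq h fun i => ?_
  obtain ⟨x, hx⟩ := (youngEquiv h).surjective (s (youngEquiv h (Sum.inl i)))
  rcases x with i' | j
  · exact ⟨i', hx.symm⟩
  · obtain ⟨j', rfl⟩ := Finite.surjective_of_injective hinj j
    rw [← hf j'] at hx
    simpa using s.injective hx

/-- Summation over cosets of the Young subgroup. -/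
theorem sum_perm_eq_sum_coset {A : Type*} [AddCommMonoid A]
    [Fintype (Perm (Fin n) ⧸ (youngEmbedding h).range)] (F : Perm (Fin n) → A) :
    ∑ g, F g = ∑ q : Perm (Fin n) ⧸ (youngEmbedding h).range,
      ∑ a, F (q.out * youngEmbedding h a) := by
  rw [← Finset.sum_product', Finset.univ_product_univ]
  symm
  refine Fintype.sum_bijective
    (fun x : (Perm (Fin n) ⧸ (youngEmbedding h).range) × _ => x.1.out * youngEmbedding h x.2)
    ⟨?_, ?_⟩ _ _ fun _ => rfl
  · rintro ⟨q, a⟩ ⟨q', a'⟩ e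
    simp only at e
    have h1 : ∀ (q : Perm (Fin n) ⧸ (youngEmbedding h).range) a,
        (QuotientGroup.mk (q.out * youngEmbedding h a) : Perm (Fin n) ⧸ (youngEmbedding h).range)
          = q := fun q a => by
      rw [QuotientGroup.mk_mul_of_mem _ (MonoidHom.mem_range.2 ⟨a, rfl⟩), QuotientGroup.out_eq']
    have h2 : q = q' := by rw [← h1 q a, e, h1]
    subst h2
    rw [youngEmbedding_injective h (mul_left_cancel e)]
  · intro g
    obtain ⟨a, ha⟩ := MonoidHom.mem_range.1 (QuotientGroup.eq.1 (QuotientGroup.out_eq'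
      (QuotientGroup.mk g : Perm (Fin n) ⧸ (youngEmbedding h).range)))
    exact ⟨⟨QuotientGroup.mk g, a⟩, by simp only [ha, mul_inv_cancel_left]⟩

theorem apply_eq_zero_of_eq_none (hlam : lam.card = t) {f : WordModule t}
    (hf : f ∈ standardSpan lam t) {w : Fin t → Option ℕ} {x : Fin t} (hw : w x = none) :
    f w = 0 := by
  induction hf using Submodule.span_induction with
  | mem f hf =>
    obtain ⟨p, rfl⟩ := hf
    by_contra hc
    obtain ⟨s, -, rfl⟩ := exists_of_polytabloid_ne_zero hc
    have := p.2.isTableau.ne_none hlam (s x)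
    obtain ⟨c, hc⟩ := Option.ne_none_iff_exists'.1 this
    simp [rowWord, hc] at hw
  | zero => rfl
  | add f g _ _ hf hg => rw [Pi.add_apply, hf, hg, add_zero]
  | smul c f _ hf => rw [Pi.smul_apply, hf, smul_zero]

/-- Translates of extensions by zero along different cosets are independent. -/
theorem eq_zero_of_sum_coset_eq_zero (hlam : lam.card = t)
    [Fintype (Perm (Fin n) ⧸ (youngEmbedding h).range)]
    (F : Perm (Fin n) ⧸ (youngEmbedding h).range → WordModule t)
    (hF : ∀ q, F q ∈ standardSpan lam t)
    (h0 : ∑ q, wordRep n q.out (extendFun h (F q)) = 0) (q) : F q = 0 := by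
  classical
  ext w
  by_cases hw : ∃ x, w x = none
  · obtain ⟨x, hx⟩ := hw
    exact apply_eq_zero_of_eq_none hlam (hF q) hx
  push Not at hw
  -- As `w` avoids `none`, the letters `none` of the translated word mark the images of the last n -
  -- t symbols. These determine the coset, so only the summand of `q` is nonzero there.
  have h1 := congrFun h0 (extendNone h w ∘ ⇑(q.out)⁻¹)
  rw [Finset.sum_apply, Finset.sum_eq_single q] at h1
  · rw [wordRep_apply, Function.comp_assoc, ← Perm.coe_mul, inv_mul_cancel, Perm.coe_one,
      Function.comp_id, extendFun_extendNone] at h1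
    exact h1
  · intro q' _ hne
    rw [wordRep_apply, Function.comp_assoc, ← Perm.coe_mul, extendFun_apply, if_neg]
    intro hall
    apply hne
    obtain ⟨a, ha⟩ := exists_youngEmbedding_eq_of_inr h (s := (q.out)⁻¹ * q'.out) fun j => by
      obtain ⟨x, hx⟩ := (youngEquiv h).surjective
        (((q.out)⁻¹ * q'.out) (youngEquiv h (Sum.inr j)))
      have := hall j
      rw [Function.comp, ← hx] at this
      rcases x with i | j'
      · rw [extendNone_inl] at this
        exact absurd this (hw i)
      · exact ⟨j', hx.symm⟩
    have := QuotientGroup.eq.2 (MonoidHom.mem_range.2 ⟨a, ha⟩)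
    rw [QuotientGroup.out_eq', QuotientGroup.out_eq'] at this
    exact this.symm
  · simp

theorem single_smul_inducedMk_one {M : Type} [AddCommGroup M] [Module (IntSym t) M]
    (g : Perm (Fin n)) (r : ℤ) (v : M) :
    (MonoidAlgebra.single g r : IntSym n) • inducedMk h M 1 v = r • inducedMk h M g⁻¹ v := by
  rw [single_smul_inducedMk, one_mul]

theorem exists_smul_inducedMk {M : Type} [AddCommGroup M] [Module (IntSym t) M] {v₀ : M}
    (hv₀ : ∀ v : M, ∃ x : IntSym t, x • v₀ = v) (v : InducedUp h M) :
    ∃ x : IntSym n, x • inducedMk h M 1 v₀ = v := by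
  refine inducedMk_induction h (P := fun v => ∃ x : IntSym n, x • inducedMk h M 1 v₀ = v)
    ?_ ⟨0, zero_smul _ _⟩ ?_ ?_ v
  · rintro _ _ ⟨x, rfl⟩ ⟨y, rfl⟩
    exact ⟨x + y, add_smul _ _ _⟩
  · rintro r _ ⟨x, rfl⟩
    exact ⟨r • x, smul_assoc _ _ _⟩
  · intro g v
    obtain ⟨y, rfl⟩ := hv₀ v
    induction y using MonoidAlgebra.induction_linear with
    | zero => exact ⟨0, by rw [zero_smul, zero_smul, map_zero]⟩
    | add x y hx hy =>
      obtain ⟨x', hx⟩ := hx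
      obtain ⟨y', hy⟩ := hy
      exact ⟨x' + y', by rw [add_smul, hx, hy, ← map_add, ← add_smul]⟩
    | single a r =>
      refine ⟨MonoidAlgebra.single (g⁻¹ * youngEmbedding h (a, 1)) r, ?_⟩
      have e : (MonoidAlgebra.single a r : IntSym t) = r • MonoidAlgebra.single a 1 := by simp
      rw [single_smul_inducedMk_one, mul_inv_rev, inv_inv, e, smul_assoc, map_smul,
        ← inducedMk_youngEmbedding h (a, 1), mul_inv_cancel_left]

theorem smul_eq_sum {A : Type*} [AddCommGroup A] [Module (IntSym n) A] (x : IntSym n) (v : A) :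
    x • v = ∑ g, x.coeff g • (MonoidAlgebra.single g 1 : IntSym n) • v := by
  have hx : x = ∑ g, MonoidAlgebra.single g (x.coeff g) := by
    conv_lhs => rw [← MonoidAlgebra.sum_coeff_single x]
    rw [Finsupp.sum_fintype _ _ (by simp)]
  conv_lhs => rw [hx]
  rw [Finset.sum_smul]
  refine Finset.sum_congr rfl fun g _ => ?_
  rw [← smul_assoc, MonoidAlgebra.smul_single, smul_eq_mul, mul_one]

/-- The part of `z` on the coset of `g`, projected to the first factor. -/
def cosetPart (z : IntSym n) (g : Perm (Fin n)) : IntSym t :=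
  ∑ a, z.coeff (g * youngEmbedding h a) • (MonoidAlgebra.single a.1 1 : IntSym t)

theorem cosetPart_smul {A : Type*} [AddCommGroup A] [Module (IntSym t) A] (z : IntSym n)
    (g : Perm (Fin n)) (v : A) : cosetPart h z g • v =
      ∑ a, z.coeff (g * youngEmbedding h a) • (MonoidAlgebra.single a.1 1 : IntSym t) • v := by
  rw [cosetPart, Finset.sum_smul]
  exact Finset.sum_congr rfl fun a _ => smul_assoc _ _ _

/-- The coset parts here are the same as in `smul_extendFun`, which lets vanishing pass from
functions of words to the induced module. -/
theorem smul_inducedMk_one {M : Type} [AddCommGroup M] [Module (IntSym t) M]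
    [Fintype (Perm (Fin n) ⧸ (youngEmbedding h).range)] (z : IntSym n) (v : M) :
    z • inducedMk h M 1 v = ∑ q : Perm (Fin n) ⧸ (youngEmbedding h).range,
      inducedMk h M q.out⁻¹ (cosetPart h z q.out • v) := by
  rw [smul_eq_sum, sum_perm_eq_sum_coset h]
  refine Finset.sum_congr rfl fun q _ => ?_
  rw [cosetPart_smul, map_sum]
  refine Finset.sum_congr rfl fun a _ => ?_
  rw [map_smul, single_smul_inducedMk_one, one_smul, mul_inv_rev, ← inducedMk_youngEmbedding h a,
    mul_inv_cancel_left]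

theorem smul_extendFun [Fintype (Perm (Fin n) ⧸ (youngEmbedding h).range)] (z : IntSym n)
    (f : WordModule t) :
    z • extendFun h f = ∑ q : Perm (Fin n) ⧸ (youngEmbedding h).range,
      wordRep n q.out (extendFun h (cosetPart h z q.out • f)) := by
  rw [smul_eq_sum, sum_perm_eq_sum_coset h]
  refine Finset.sum_congr rfl fun q _ => ?_
  rw [cosetPart_smul, map_sum, map_sum]
  refine Finset.sum_congr rfl fun a _ => ?_
  rw [map_smul, map_smul, single_smul, single_smul, one_smul, one_smul, extendFun_wordRep,
    (wordRep n).map_mul, Module.End.mul_apply]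

/-- Independence of the coset translates shows that every coset part of `z` kills the polytabloid on
t symbols, hence `v₀`. -/
theorem smul_inducedMk_eq_zero (hlam : lam.card = t) {M : Type} [AddCommGroup M]
    [Module (IntSym t) M] {v₀ : M}
    (hv₀ : ∀ y : IntSym t, y • T.filling.polytabloid = 0 → y • v₀ = 0) {z : IntSym n}
    (hz : z • polytabloid (extendNone h T.filling) = 0) : z • inducedMk h M 1 v₀ = 0 := by
  let _ := Fintype.ofFinite (Perm (Fin n) ⧸ (youngEmbedding h).range)
  rw [← extendFun_polytabloid, smul_extendFun] at hz
  have h3 := eq_zero_of_sum_coset_eq_zero h hlam _ (fun q =>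
    (spechtWord lam t).smul_mem (cosetPart h z q.out) T.isTableau_filling.polytabloid_mem) hz
  rw [smul_inducedMk_one]
  refine Finset.sum_eq_zero fun q _ => ?_
  rw [hv₀ _ (h3 q), map_zero]

/-- The universal property of induction. A ℤ-linear map with known values on the elements `inducedMk
h M g v` is enough to compare annihilators. -/
theorem exists_induced_lift {M : Type} [AddCommGroup M] [Module (IntSym t) M] {Q : Type*}
    [AddCommGroup Q] [Module (IntSym n) Q] (f : M →ₗ[ℤ] Q)
    (hf : ∀ (a : Perm (Fin t) × Perm (Fin (n - t))) v,
      f ((MonoidAlgebra.single a.1 1 : IntSym t) • v) =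
        (MonoidAlgebra.single (youngEmbedding h a) 1 : IntSym n) • f v) :
    ∃ F : InducedUp h M →ₗ[ℤ] Q, ∀ g v,
      F (inducedMk h M g v) = (MonoidAlgebra.single g⁻¹ 1 : IntSym n) • f v := by
  let B : IntSym n →ₗ[ℤ] (M ⊗[ℤ] ℤ →ₗ[ℤ] Q) := (Finsupp.lift _ _ _ fun g =>
      Algebra.lsmul ℤ ℤ Q (MonoidAlgebra.single g⁻¹ 1 : IntSym n) ∘ₗ f ∘ₗ
        (TensorProduct.rid ℤ M).toLinearMap) ∘ₗ (MonoidAlgebra.coeffLinearEquiv ℤ).toLinearMap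
  have hB : ∀ g r v z, B (MonoidAlgebra.single g r) (v ⊗ₜ z) =
      r • (MonoidAlgebra.single g⁻¹ 1 : IntSym n) • z • f v := by
    intro g r v z
    have h1 : B (MonoidAlgebra.single g r) = r • (Algebra.lsmul ℤ ℤ Q
        (MonoidAlgebra.single g⁻¹ 1 : IntSym n) ∘ₗ f ∘ₗ (TensorProduct.rid ℤ M).toLinearMap) := by
      simp [B]
      rfl
    rw [h1]
    change r • (MonoidAlgebra.single g⁻¹ 1 : IntSym n) • f (z • v) = _
    rw [map_smul]
  have hinv : ∀ a, TensorProduct.lift B ∘ₗ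
      Representation.tprod ((Representation.leftRegular ℤ (Perm (Fin n))).comp (youngEmbedding h))
        (outerTrivial t n M) a = TensorProduct.lift B := by
    intro a
    refine TensorProduct.ext' fun y w => ?_
    rw [LinearMap.comp_apply, Representation.tprod_apply, TensorProduct.map_tmul,
      TensorProduct.lift.tmul, TensorProduct.lift.tmul]
    induction y using MonoidAlgebra.induction_linear with
    | zero => simp
    | add x y hx hy => rw [map_add, map_add, map_add, LinearMap.add_apply, LinearMap.add_apply, hx, hy]
    | single g r =>
      induction w using TensorProduct.induction_on with
      | zero => simp
      | add x y hx hy => rw [map_add, map_add, map_add, hx, hy]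
      | tmul v z =>
        have h1 : ((Representation.leftRegular ℤ (Perm (Fin n))).comp (youngEmbedding h)) a
            (MonoidAlgebra.single g r) = MonoidAlgebra.single (youngEmbedding h a * g) r := by
          simp
        rw [h1, outerTrivial_tmul, hB, hB, hf, smul_comm z, ← mul_smul,
          MonoidAlgebra.single_mul_single, mul_inv_rev, inv_mul_cancel_right, one_mul]
  refine ⟨Representation.Coinvariants.lift _ (TensorProduct.lift B) hinv ∘ₗ
    (Representation.ind (youngEmbedding h) (outerTrivial t n M)).asModuleEquiv.toLinearMap,
    fun g v => ?_⟩
  have h2 : (Representation.Coinvariants.lift _ (TensorProduct.lift B) hinv ∘ₗ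
    (Representation.ind (youngEmbedding h) (outerTrivial t n M)).asModuleEquiv.toLinearMap)
      (inducedMk h M g v) = B (MonoidAlgebra.single g 1) (v ⊗ₜ 1) := rfl
  exact h2.trans (by rw [hB, one_smul, one_smul])

/-- If a map out of `M` induces a map out of the induced module, it controls annihilators. -/
theorem smul_eq_zero_of_smul_inducedMk_eq_zero {M : Type} [AddCommGroup M] [Module (IntSym t) M]
    {Q : Type*} [AddCommGroup Q] [Module (IntSym n) Q] (f : M →ₗ[ℤ] Q)
    (hf : ∀ (a : Perm (Fin t) × Perm (Fin (n - t))) v,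
      f ((MonoidAlgebra.single a.1 1 : IntSym t) • v) =
        (MonoidAlgebra.single (youngEmbedding h a) 1 : IntSym n) • f v)
    (x : IntSym n) (v : M) (hx : x • inducedMk h M 1 v = 0) : x • f v = 0 := by
  obtain ⟨F, hF⟩ := exists_induced_lift h f hf
  rw [← map_zero F, ← hx, smul_eq_sum x (f v), smul_eq_sum x, map_sum]
  refine Finset.sum_congr rfl fun g _ => ?_
  rw [single_smul_inducedMk_one, one_smul, map_smul, hF, inv_inv]

/-- The class of the generator of the Specht module. -/
def spechtModGen (m : ℕ) : T.SpechtMod m := Submodule.Quotient.mk T.spechtGen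

theorem exists_smul_spechtModGen (v : T.SpechtMod m) : ∃ x : IntSym t, x • spechtModGen T m = v := by
  obtain ⟨v, rfl⟩ := Submodule.Quotient.mk_surjective _ v
  obtain ⟨y, rfl⟩ := T.exists_smul_spechtGen v
  exact ⟨y, rfl⟩

theorem smul_spechtModGen_eq_zero (y : IntSym t) (hy : y • T.filling.polytabloid = 0) :
    y • spechtModGen T m = 0 := by
  rw [spechtModGen, ← Submodule.Quotient.mk_smul, (T.smul_spechtGen_eq_zero_iff y).2 hy,
    Submodule.Quotient.mk_zero]

theorem natCast_smul_spechtModGen : (m : ℤ) • spechtModGen T m = 0 := by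
  rw [spechtModGen, natCast_zsmul, ← Submodule.Quotient.mk_smul, Submodule.Quotient.mk_eq_zero]
  exact ⟨T.spechtGen, rfl⟩

/-- The multiples of `m` in the span of the standard polytabloids. -/
def mulSpecht (m : ℕ) (lam : YoungDiagram) (n : ℕ) : Submodule (IntSym n) (WordModule n) :=
  toSubmodule ((standardSpan lam n).map (LinearMap.lsmul ℤ (WordModule n) m)) fun g f hf => by
    obtain ⟨f, hf, rfl⟩ := hf
    exact ⟨wordRep n g f, wordRep_mem_standardSpan g hf, (map_smul (wordRep n g) (m : ℤ) f).symm⟩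

theorem mem_mulSpecht {f : WordModule n} :
    f ∈ mulSpecht m lam n ↔ ∃ f' ∈ standardSpan lam n, f = (m : ℤ) • f' :=
  ⟨fun ⟨f', hf', e⟩ => ⟨f', hf', e.symm⟩, fun ⟨f', hf', e⟩ => ⟨f', hf', e.symm⟩⟩

theorem exists_spechtMod_map (m : ℕ) : ∃ f : T.SpechtMod m →ₗ[ℤ] WordModule n ⧸ mulSpecht m lam n,
    f (spechtModGen T m) = Submodule.Quotient.mk (polytabloid (extendNone h T.filling)) ∧
    ∀ (a : Perm (Fin t) × Perm (Fin (n - t))) v,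
      f ((MonoidAlgebra.single a.1 1 : IntSym t) • v) =
        (MonoidAlgebra.single (youngEmbedding h a) 1 : IntSym n) • f v := by
  obtain ⟨e, he⟩ := T.exists_spechtEquiv
  let f₀ : T.specht →+ WordModule n ⧸ mulSpecht m lam n :=
    AddMonoidHom.mk' (fun v => Submodule.Quotient.mk (extendFun h (e v : WordModule t)))
      fun v w => by rw [map_add, Submodule.coe_add, map_add, Submodule.Quotient.mk_add]
  let f : T.SpechtMod m →+ WordModule n ⧸ mulSpecht m lam n := QuotientAddGroup.lift _ f₀ (by
    rintro _ ⟨v, rfl⟩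
    rw [AddMonoidHom.mem_ker]
    change Submodule.Quotient.mk (extendFun h (e (m • v) : WordModule t)) = _
    rw [Submodule.Quotient.mk_eq_zero, mem_mulSpecht, map_nsmul, AddSubmonoidClass.coe_nsmul,
      map_nsmul]
    exact ⟨_, extendFun_mem_standardSpan h (e v).2, (natCast_zsmul _ _).symm⟩)
  have hf : ∀ v : T.specht, f (Submodule.Quotient.mk v) =
      Submodule.Quotient.mk (extendFun h (e v : WordModule t)) := fun _ => rfl
  refine ⟨f.toIntLinearMap, ?_, fun a v => ?_⟩
  · have h1 := he 1
    rw [one_smul, one_smul] at h1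
    rw [AddMonoidHom.coe_toIntLinearMap, spechtModGen, hf, h1, extendFun_polytabloid]
  · obtain ⟨v, rfl⟩ := Submodule.Quotient.mk_surjective _ v
    rw [← Submodule.Quotient.mk_smul, AddMonoidHom.coe_toIntLinearMap, hf, hf, map_smul,
      Submodule.coe_smul, single_smul, one_smul, extendFun_wordRep, ← Submodule.Quotient.mk_smul,
      single_smul, one_smul]

theorem zsmul_smul_eq_zero {A : Type*} [AddCommGroup A] [Module (IntSym n) A] {c : ℤ} {w : A}
    (hw : c • w = 0) (y : IntSym n) : (c • y) • w = 0 := by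
  rw [smul_assoc, smul_comm, hw, smul_zero]

theorem zsmul_inducedMk_eq_zero {M : Type} [AddCommGroup M] [Module (IntSym t) M] {c : ℤ} {v : M}
    (hv : c • v = 0) : c • inducedMk h M 1 v = 0 := by
  rw [← map_zsmul, hv, map_zero]

/-- The annihilator of the generator of the induced module. -/
theorem smul_inducedMk_eq_zero_iff (hlam : lam.card = t) (x : IntSym n) :
    x • inducedMk h (T.SpechtMod m) 1 (spechtModGen T m) = 0 ↔
      x • polytabloid (extendNone h T.filling) ∈ mulSpecht m lam n := by
  constructor
  · intro hx
    obtain ⟨f, hf1, hf2⟩ := exists_spechtMod_map h T m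
    have := smul_eq_zero_of_smul_inducedMk_eq_zero h f hf2 x _ hx
    rwa [hf1, ← Submodule.Quotient.mk_smul, Submodule.Quotient.mk_eq_zero] at this
  · intro hx
    obtain ⟨f, hf, hxf⟩ := mem_mulSpecht.1 hx
    -- Now `x - m y` kills the extended polytabloid and therefore the generator, while `m y` kills
    -- the generator because m does.
    obtain ⟨y, rfl⟩ := (T.isTableau_filling.extendNone h).mem_spechtWord_iff.1 hf
    have h1 : (x - (m : ℤ) • y) • polytabloid (extendNone h T.filling) = 0 := by
      rw [sub_smul, hxf, smul_assoc, sub_self]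
    have h2 := smul_inducedMk_eq_zero h T hlam (smul_spechtModGen_eq_zero (m := m) T) h1
    have h3 : ((m : ℤ) • y) • inducedMk h (T.SpechtMod m) 1 (spechtModGen T m) = 0 :=
      zsmul_smul_eq_zero (zsmul_inducedMk_eq_zero h (natCast_smul_spechtModGen T)) y
    rwa [sub_smul, h3, sub_zero] at h2

end Induced

/-! ### The Specht series of a cyclic module. -/

open scoped Classical in
/-- The diagrams interlacing with `lam`, enumerated by increasing depth. -/
theorem exists_isStripList (lam : YoungDiagram) (n : ℕ) :
    ∃ (k : ℕ) (e : Fin k ≃ {nu : YoungDiagram // nu.card = n ∧ Interlaces lam nu})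
      (d : ℕ → YoungDiagram), (∀ i, d (i : Fin k) = (e i).1) ∧ IsStripList lam n k d := by
  have : Finite {nu : YoungDiagram // nu.card = n ∧ Interlaces lam nu} :=
    ((YoungDiagram.finite_setOf_card_eq n).subset fun _ h => h.1).to_subtype
  obtain ⟨k, ⟨e₀⟩⟩ := Finite.exists_equiv_fin
    {nu : YoungDiagram // nu.card = n ∧ Interlaces lam nu}
  let F : Fin k → ℕ := fun i => (e₀.symm i).1.depth
  let e := (Tuple.sort F).trans e₀.symm
  let d : ℕ → YoungDiagram := fun i => if h : i < k then (e ⟨i, h⟩).1 else ⊥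
  have hd : ∀ i (h : i < k), d i = (e ⟨i, h⟩).1 := fun i h => dif_pos h
  have hd' : ∀ i : Fin k, d i = (e i).1 := fun i => hd i i.2
  refine ⟨k, e, d, hd', ?_, ?_, ?_, ?_, ?_⟩
  · intro i h
    rw [hd i h]
    exact (e ⟨i, h⟩).2.1
  · intro i h
    rw [hd i h]
    exact (e ⟨i, h⟩).2.2
  · intro i j hij hj
    rw [hd i (hij.trans hj), hd j hj]
    exact Tuple.monotone_sort F (Fin.mk_le_mk.2 hij.le)
  · intro i j hij hj h
    rw [hd i (hij.trans hj), hd j hj] at h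
    have := e.injective (Subtype.ext h)
    simp only [Fin.mk.injEq] at this
    omega
  · rw [← sum_card_standards n lam, Finset.sum_range]
    refine Finset.sum_bij (fun i _ => d i) (fun i _ => ?_) (fun i _ j _ h => ?_)
      (fun nu h => ?_) fun _ _ => rfl
    · rw [hd', Finset.mem_filter, YoungDiagram.mem_ofCard]
      exact (e i).2
    · rw [hd', hd'] at h
      exact e.injective (Subtype.ext h)
    · rw [Finset.mem_filter, YoungDiagram.mem_ofCard] at h
      exact ⟨e.symm ⟨nu, h⟩, Finset.mem_univ _, by rw [hd', e.apply_symm_apply]⟩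

section Series

variable {lam : YoungDiagram} {n k m : ℕ} {d : ℕ → YoungDiagram}

/-- `stratum` as a module over the group ring. -/
def stratumModule (lam : YoungDiagram) (n : ℕ) (d : ℕ → YoungDiagram) (i : ℕ) :
    Submodule (IntSym n) (WordModule n) :=
  toSubmodule (stratum lam n d i) fun g _ hf => wordRep_mem_stratum g hf

theorem mem_stratumModule {i : ℕ} {f : WordModule n} :
    f ∈ stratumModule lam n d i ↔ f ∈ stratum lam n d i := Iff.rfl

/-- The submodule of a quotient of the group ring induced by a stratum. -/
def stratumImage {A : Type*} [AddCommGroup A] [Module (IntSym n) A]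
    (κ : IntSym n →ₗ[IntSym n] WordModule n) (π : IntSym n →ₗ[IntSym n] A)
    (lam : YoungDiagram) (d : ℕ → YoungDiagram) (i : ℕ) : Submodule (IntSym n) A :=
  ((stratumModule lam n d i).comap κ).map π

variable {A : Type*} [AddCommGroup A] [Module (IntSym n) A]
  {κ : IntSym n →ₗ[IntSym n] WordModule n} {π : IntSym n →ₗ[IntSym n] A}

theorem stratumImage_zero (hκ : ∀ x, κ x ∈ standardSpan lam n) (hπ : Function.Surjective π) :
    stratumImage κ π lam d 0 = ⊤ := by
  have : (stratumModule lam n d 0).comap κ = ⊤ := by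
    ext x
    simp [mem_stratumModule, mem_stratum, hκ]
  rw [stratumImage, this, Submodule.map_top, LinearMap.range_eq_top.2 hπ]

theorem stratumImage_succ_le (i : ℕ) :
    stratumImage κ π lam d (i + 1) ≤ stratumImage κ π lam d i :=
  Submodule.map_mono (Submodule.comap_mono fun _ hf => (mem_stratum_succ.1 hf).1)

theorem stratumImage_last (hd : IsStripList lam n k d)
    (hπκ : ∀ x, π x = 0 ↔ κ x ∈ mulSpecht m lam n) : stratumImage κ π lam d k = ⊥ := by
  rw [eq_bot_iff]
  rintro _ ⟨x, hx, rfl⟩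
  rw [SetLike.mem_coe, Submodule.mem_comap, mem_stratumModule, hd.stratum_eq_bot,
    Submodule.mem_bot] at hx
  rw [Submodule.mem_bot, hπκ, hx]
  exact zero_mem _

/-- The successive quotients of the series are the Specht modules modulo `m`. -/
theorem nonempty_stratumImage_quotient (hd : IsStripList lam n k d)
    (hκ : ∀ f, f ∈ standardSpan lam n ↔ ∃ x, κ x = f)
    (hπκ : ∀ x, π x = 0 ↔ κ x ∈ mulSpecht m lam n) {i : ℕ} (hi : i < k)
    (U : YoungTableau (d i) n) :
    Nonempty ((stratumImage κ π lam d i ⧸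
      (stratumImage κ π lam d (i + 1)).submoduleOf (stratumImage κ π lam d i)) ≃ₗ[IntSym n]
        U.SpechtMod m) := by
  obtain ⟨E, -⟩ := U.exists_spechtEquiv
  let S := (stratumModule lam n d i).comap κ
  have hmap : ∀ f, f ∈ standardSpan (d i) n ↔ ∃ x ∈ stratum lam n d i, fillHom (d i) x = f :=
    fun f => by rw [← hd.map_eq hi]; rfl
  have hlift : ∀ f ∈ stratum lam n d i, ∃ a ∈ S, κ a = f := fun f hf => by
    obtain ⟨x, rfl⟩ := (hκ f).1 (stratum_le i hf)
    exact ⟨x, hf, rfl⟩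
  let θ : S →ₗ[IntSym n] spechtWord (d i) n :=
    ((fillMap (d i) ∘ₗ κ) ∘ₗ S.subtype).codRestrict _ fun a => (hmap _).2 ⟨_, a.2, rfl⟩
  have hθ : ∀ a : S, (θ a : WordModule n) = fillHom (d i) (κ a) := fun _ => rfl
  have hθs : Function.Surjective θ := by
    rintro ⟨f, hf⟩
    obtain ⟨x, hx, rfl⟩ := (hmap f).1 hf
    obtain ⟨a, ha, rfl⟩ := hlift x hx
    exact ⟨⟨a, ha⟩, rfl⟩
  let R := LinearMap.range (m • (LinearMap.id : U.specht →ₗ[IntSym n] U.specht))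
  -- Both modules become targets of epimorphisms from the preimage `S` of the stratum: `f` here and
  -- `g` below. It remains to compare kernels.
  let f : S →ₗ[IntSym n] U.SpechtMod m := R.mkQ ∘ₗ E.symm.toLinearMap ∘ₗ θ
  have hfs : Function.Surjective f :=
    R.mkQ_surjective.comp (E.symm.surjective.comp hθs)
  have hf0 : ∀ a, f a = 0 ↔ ∃ b : S, fillHom (d i) (κ a) = (m : ℤ) • fillHom (d i) (κ b) := by
    intro a
    change Submodule.Quotient.mk (E.symm (θ a)) = (0 : U.SpechtMod m) ↔ _
    rw [Submodule.Quotient.mk_eq_zero]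
    constructor
    · rintro ⟨s, hs⟩
      obtain ⟨b, hb⟩ := hθs (E s)
      refine ⟨b, ?_⟩
      have h1 : θ a = m • E s := by
        rw [← map_nsmul]
        exact ((LinearEquiv.eq_symm_apply _).1 hs).symm
      rw [← hθ, ← hθ, h1, hb, natCast_zsmul]
      rfl
    · rintro ⟨b, hb⟩
      refine ⟨E.symm (θ b), ?_⟩
      have h1 : θ a = m • θ b := by
        apply Subtype.ext
        rw [AddSubmonoidClass.coe_nsmul, hθ, hθ, hb, natCast_zsmul]
      rw [h1, map_nsmul]
      rfl
  let N' := stratumImage κ π lam d (i + 1)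
  let g : S →ₗ[IntSym n] (stratumImage κ π lam d i ⧸
      N'.submoduleOf (stratumImage κ π lam d i)) :=
    (N'.submoduleOf (stratumImage κ π lam d i)).mkQ ∘ₗ
      (π ∘ₗ S.subtype).codRestrict _ fun a => ⟨a, a.2, rfl⟩
  have hgs : Function.Surjective g := by
    refine (Submodule.mkQ_surjective _).comp ?_
    rintro ⟨_, a, ha, rfl⟩
    exact ⟨⟨a, ha⟩, rfl⟩
  have hg0 : ∀ a : S, g a = 0 ↔ ∃ b : IntSym n, κ b ∈ stratum lam n d (i + 1) ∧ π b = π a := by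
    intro a
    change Submodule.Quotient.mk _ = _ ↔ _
    rw [Submodule.Quotient.mk_eq_zero]
    rfl
  obtain ⟨e, -⟩ := exists_linearEquiv_of_eq_zero_iff g f hgs hfs fun a => by
    rw [hf0, hg0]
    constructor
    · rintro ⟨b, hb, hab⟩
      obtain ⟨v, hv, hav⟩ := mem_mulSpecht.1 ((hπκ (a - b)).1 (by rw [map_sub, hab, sub_self]))
      have hb' := mem_stratum_succ.1 hb
      have hfa : fillHom (d i) (κ a) = (m : ℤ) • fillHom (d i) v := by
        rw [← map_smul, ← hav, map_sub, map_sub, hb'.2, sub_zero]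
      -- For `m = 0` the multiple of `v` disappears and any witness serves. Otherwise purity puts
      -- `v` into the stratum.
      rcases eq_or_ne m 0 with rfl | hm0
      · exact ⟨a, by rw [hfa, Nat.cast_zero, zero_smul, zero_smul]⟩
      · have hvs : v ∈ stratum lam n d i :=
          mem_stratum_of_smul_mem (Nat.cast_ne_zero.2 hm0) (by
            rw [← hav, map_sub]
            exact sub_mem a.2 hb'.1)
        obtain ⟨c, hc, rfl⟩ := hlift v hvs
        exact ⟨⟨c, hc⟩, hfa⟩
    · rintro ⟨b, hb⟩
      have hκs : κ ((m : ℤ) • (b : IntSym n)) = (m : ℤ) • κ b := map_zsmul κ _ _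
      -- Subtracting m b moves `a` into the next stratum without changing its image under `π`.
      refine ⟨a - (m : ℤ) • (b : IntSym n), mem_stratum_succ.2 ⟨?_, ?_⟩, ?_⟩
      · rw [map_sub, hκs]
        exact sub_mem a.2 (Submodule.smul_mem _ _ b.2)
      · rw [map_sub, hκs, map_sub, map_smul, hb, sub_self]
      · rw [map_sub, sub_eq_self, hπκ, hκs]
        exact mem_mulSpecht.2 ⟨_, stratum_le _ b.2, rfl⟩
  exact ⟨e⟩

/-- A quotient of the group ring whose annihilator is described by the extended polytabloid has
a Specht series. -/
theorem exists_specht_series {p : Filling n} (hp : p.IsTableau lam) {w : A}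
    (hw : ∀ v, ∃ x : IntSym n, x • w = v)
    (hwp : ∀ x : IntSym n, x • w = 0 ↔ x • p.polytabloid ∈ mulSpecht m lam n) :
    ∃ (k : ℕ) (e : Fin k ≃ {nu : YoungDiagram // nu.card = n ∧ Interlaces lam nu})
      (N : Fin (k + 1) → Submodule (IntSym n) A), N 0 = ⊤ ∧ N (Fin.last k) = ⊥ ∧
      ∀ i : Fin k, N i.succ ≤ N i.castSucc ∧
        ∀ U : YoungTableau (e i).1 n,
          Nonempty ((N i.castSucc ⧸ (N i.succ).submoduleOf (N i.castSucc)) ≃ₗ[IntSym n]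
            U.SpechtMod m) := by
  obtain ⟨k, e, d, hde, hd⟩ := exists_isStripList lam n
  let κ := LinearMap.toSpanSingleton (IntSym n) (WordModule n) p.polytabloid
  let π := LinearMap.toSpanSingleton (IntSym n) A w
  have hκ : ∀ f, f ∈ standardSpan lam n ↔ ∃ x, κ x = f := fun f => hp.mem_spechtWord_iff
  have hπκ : ∀ x, π x = 0 ↔ κ x ∈ mulSpecht m lam n := hwp
  refine ⟨k, e, fun i => stratumImage κ π lam d i,
    stratumImage_zero (fun x => (hκ _).2 ⟨x, rfl⟩) hw, stratumImage_last hd hπκ,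
    fun i => ⟨stratumImage_succ_le _, ?_⟩⟩
  rw [← hde i]
  exact fun U => nonempty_stratumImage_quotient hd hκ hπκ i.2 U

end Series

end

theorem mainTheorem5 (t n m : ℕ) (ht : 0 < t) (htn : t < n)
    (lam : YoungDiagram) (hlam : lam.card = t) (T : YoungTableau lam t) :
    ∃ (k : ℕ) (e : Fin k ≃ {nu : YoungDiagram // nu.card = n ∧ Interlaces lam nu})
      (N : Fin (k + 1) → Submodule (IntSym n) (InducedUp htn (T.SpechtMod m))),
      N 0 = ⊤ ∧ N (Fin.last k) = ⊥ ∧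
      ∀ i : Fin k, N i.succ ≤ N i.castSucc ∧
        ∀ U : YoungTableau (e i).1 n,
          Nonempty ((N i.castSucc ⧸ (N i.succ).submoduleOf (N i.castSucc)) ≃ₗ[IntSym n]
            U.SpechtMod m) := by
  exact exists_specht_series (T.isTableau_filling.extendNone htn)
    (exists_smul_inducedMk htn (exists_smul_spechtModGen T))
    (smul_inducedMk_eq_zero_iff htn T hlam)
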